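/- Let $\mathrm{Sym}^2(\mathbb R^n)$ be the space of symmetric $n\times n$ matrices with the inner product $\langle A,B\rangle=\mathrm{tr}(AB)$, and let $\mathcal P^+\subset \mathrm{Sym}^2(\mathbb R^n)$ be a closed convex cone with vertex at the origin, with polar $\mathcal P_+=\{A:\langle A,B\rangle\ge 0\ \text{for all } B\in\mathcal P^+\}$. Assume that $\mathcal P^+$ is elliptic: every $A$ in the interior of $\mathcal P_+$ relative to the linear span of $\mathcal P_+$ is positive definite. Let $X\subset\mathbb R^n$ be open. Let $\mathrm{PSH}^{\rm dist}(X)$ be the set of $\mathcal P^+$-plurisubharmonic distributions on $X$, i.e. of those $u\in\mathcal D'(X)$ with $\big(\sum_{i,j}A_{ij}\,\partial_i\partial_j u\big)(\varphi)\ge 0$ for all $A\in\mathcal P_+$ and all test functions $0\le\varphi\in C^\infty_{\rm cpt}(X)$. Let $\mathrm{USC}(X)$ be the set of upper semicontinuous functions $X\to[-\infty,\infty)$ that are not identically $-\infty$ on any connected component of $X$. For $g\in L^1_{\rm loc}(X)$ put $$\widetilde g(x)=\operatorname*{ess\,limsup}_{y\to x} g(y)=\inf_{r>0}\ \operatorname*{ess\,sup}_{B_r(x)}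 g ,\qquad x\in X .$$ 1. Every $u\in\mathrm{PSH}^{\rm dist}(X)$ is (integration against) a function $g\in L^1_{\rm loc}(X)$. For every such $g$, the function $\widetilde g$ belongs to $\mathrm{USC}(X)$ and $\widetilde g=g$ almost everywhere on $X$, and $\widetilde g$ depends only on $u$. It is called the canonical representative $\widetilde u$ of $u$. 2. Let $\mathrm{PSH}^{\rm u.s.c.}(X)$, the set of upper semicontinuous $\mathcal P^+$-plurisubharmonic functions on $X$, consist of the canonical representatives $\widetilde u\in\mathrm{USC}(X)$ of all $u\in\mathrm{PSH}^{\rm dist}(X)$. Then $u\mapsto\widetilde u$ is an isomorphism of convex cones from $\mathrm{PSH}^{\rm dist}(X)$ to $\mathrm{PSH}^{\rm u.s.c.}(X)$: it is a bijection, and for $u,v\in\mathrm{PSH}^{\rm dist}(X)$ and real $a,b\ge 0$ one has $au+bv\in\mathrm{PSH}^{\rm dist}(X)$ and $\widetilde{au+bv}=a\widetilde u+b\widetilde v$ pointwise on $X$, where $0\cdot(-\infty)=0$. -/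

import Mathlib

open MeasureTheory Set TopologicalSpace
open scoped Distributions LineDeriv Topology

noncomputable section

namespace PPlus

/-- Euclidean space `ℝⁿ`. -/
abbrev Euc (n : ℕ) : Type := EuclideanSpace ℝ (Fin n)

/-- The subspace of symmetric matrices in the space of real `n × n` matrices. -/
def symSubmodule (n : ℕ) : Submodule ℝ (Matrix (Fin n) (Fin n) ℝ) where
  carrier := {A | A.IsSymm}
  add_mem' hA hB := Matrix.IsSymm.add hA hB
  zero_mem' := Matrix.isSymm_zero
  smul_mem' c _ hA := Matrix.IsSymm.smul hA c

/-- `Sym²(ℝⁿ)`, the real vector space of symmetric `n × n` matrices (quadratic forms on `ℝⁿ`). -/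
abbrev SymMat (n : ℕ) : Type := ↥(symSubmodule n)

/-- The trace inner product `⟨A, B⟩ = tr (A B)` on `Sym²(ℝⁿ)`. -/
def traceInner {n : ℕ} (A B : SymMat n) : ℝ := Matrix.trace (A.1 * B.1)

/-- The polar `P₊ = {A : ⟨A, B⟩ ≥ 0 for all B ∈ P⁺}` of a closed convex cone `P⁺ ⊆ Sym²(ℝⁿ)`
with vertex at the origin. -/
def polarCone {n : ℕ} (P : ProperCone ℝ (SymMat n)) : Set (SymMat n) :=
  {A | ∀ B ∈ P, 0 ≤ traceInner A B}

/-- The interior of a cone `C` relative to its linear span: the points of `C` that have a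
neighbourhood in `span C` contained in `C`. For `C = P₊` this is `Int P₊`, the interior relative
to `S(P₊)`. -/
def relInt {n : ℕ} (C : Set (SymMat n)) : Set (SymMat n) :=
  {A | A ∈ C ∧ C ∈ 𝓝[(Submodule.span ℝ C : Set (SymMat n))] A}

/-- `P⁺` is an elliptic cone: each `A ∈ Int P₊` is positive definite. -/
def IsEllipticCone {n : ℕ} (P : ProperCone ℝ (SymMat n)) : Prop :=
  ∀ A ∈ relInt (polarCone P), A.1.PosDef

/-- The `(i, j)` entry `∂ᵢ ∂ⱼ u` of the Hessian of a distribution `u`. -/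
def hess {n : ℕ} {X : Opens (Euc n)} (u : 𝓓'(X, ℝ)) : Matrix (Fin n) (Fin n) 𝓓'(X, ℝ) :=
  Matrix.of fun i j => ∂_{(EuclideanSpace.single i (1 : ℝ) : Euc n)}
    (∂_{(EuclideanSpace.single j (1 : ℝ) : Euc n)} u)

/-- The distribution `⟨Hess u, A⟩ = ∑ᵢⱼ Aᵢⱼ ∂ᵢ ∂ⱼ u`; its value at a test function `φ` is
`(Hess u)(φ A)`. -/
def hessPairing {n : ℕ} {X : Opens (Euc n)} (u : 𝓓'(X, ℝ)) (A : SymMat n) : 𝓓'(X, ℝ) :=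
  ∑ i, ∑ j, A.1 i j • hess u i j

/-- `PSH^dist(X)`: the distributions `u` on `X` with `(Hess u)(φ A) ≥ 0` for all `A ∈ P₊` and all
test functions `φ ≥ 0`. -/
def PSHdist {n : ℕ} (P : ProperCone ℝ (SymMat n)) (X : Opens (Euc n)) : Set 𝓓'(X, ℝ) :=
  {u | ∀ A ∈ polarCone P, ∀ φ : 𝓓(X, ℝ), (∀ x, 0 ≤ φ x) → 0 ≤ hessPairing u A φ}

/-- The distribution `u` on `X` is (integration against) the function `g ∈ L¹_loc(X)`. -/
def IsDensity {n : ℕ} {X : Opens (Euc n)} (u : 𝓓'(X, ℝ)) (g : Euc n → ℝ) : Prop :=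
  LocallyIntegrableOn g (X : Set (Euc n)) volume ∧
    ∀ φ : 𝓓(X, ℝ), u φ = ∫ x, g x * φ x

/-- The essential limit superior `ess limsup_{y → x} g(y)`, `x ∈ X`, of a function `g` on `X`:
the infimum over `r > 0` of the essential suprema of `g` on the balls `B_r(x)`.
(`X` is open, so the values of `g` outside of `X` do not matter.) -/
def essLimsup {n : ℕ} (X : Opens (Euc n)) (g : Euc n → ℝ) : X → EReal := fun x =>
  ⨅ (r : ℝ) (_ : 0 < r),
    essSup (fun y => (g y : EReal)) (volume.restrict (Metric.ball (x : Euc n) r))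

/-- `USC(X)`: the upper semicontinuous functions `X → [-∞, ∞)` that are not identically `-∞` on
any connected component of `X`. -/
def USC {n : ℕ} (X : Opens (Euc n)) : Set (X → EReal) :=
  {f | UpperSemicontinuous f ∧ (∀ x, f x ≠ ⊤) ∧ ∀ x, ∃ y ∈ connectedComponent x, f y ≠ ⊥}

/-- `g` is `L¹_loc`-upper-semicontinuous on `X`: its essential limit superior belongs to `USC(X)`
and to the `L¹_loc(X)`-class of `g`. -/
def IsL1locUSC {n : ℕ} (X : Opens (Euc n)) (g : Euc n → ℝ) : Prop :=
  LocallyIntegrableOn g (X : Set (Euc n)) volume ∧ essLimsup X g ∈ USC X ∧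
    ∀ᵐ x : Euc n, ∀ hx : x ∈ X, essLimsup X g ⟨x, hx⟩ = (g x : EReal)

open Classical in
/-- The canonical representative `ũ` of a distribution `u` that is an `L¹_loc` function: the
essential limit superior of (any choice of) that function. For other distributions the value `⊥`
is a placeholder. -/
def canonicalRep {n : ℕ} {X : Opens (Euc n)} (u : 𝓓'(X, ℝ)) : X → EReal :=
  if h : ∃ g : Euc n → ℝ, IsDensity u g then essLimsup X h.choose else fun _ => ⊥

/-- `PSH^u.s.c.(X)`: the upper semicontinuous `P⁺`-plurisubharmonic functions on `X`, that is, the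
canonical representatives in `USC(X)` of the `P⁺`-plurisubharmonic distributions on `X`. -/
def PSHusc {n : ℕ} (P : ProperCone ℝ (SymMat n)) (X : Opens (Euc n)) : Set (X → EReal) :=
  {f | f ∈ USC X ∧ ∃ u ∈ PSHdist P X, f = canonicalRep u}

end PPlus

end

/-! Ellipticity supplies one positive definite `A` in the polar cone
(`IsEllipticCone.exists_operator`). Every `u ∈ PSHdist P X` is therefore subharmonic for the single
constant-coefficient elliptic operator `L = ∑ Aᵢⱼ ∂ᵢ∂ⱼ`, and the classical method of decreasing
regularizations applies.

Let `B = A⁻¹` and `Q(z) = bil B z z`. The bumps `ker B τ` are functions of `Q` of total mass one,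
supported in the ball of radius `e^τ`. Their derivative in `τ` is `L (pot B τ)` with `pot B τ ≥ 0`
of compact support (`secondOrder_pot`), so the averages `reg B u τ x` increase with `τ`
(`reg_mono`). They are continuous in `x` and converge weakly to `u` as `τ → -∞`
(`tendsto_integral_mul_reg`). These facts need `u` to commute with integrals of smooth families of
test functions (`ev_setIntegral`).

The pointwise limit `envelope B u` of the averages carries everything else. Monotone convergence,
with integrals controlled by the weak limit, makes it an `L¹_loc` density of `u`
(`isDensity_envelope`). An infimum of continuous functions, it is upper semicontinuous. At every
point it equals the essential limsup of any density (`essLimsup_eq_envelope`): strict upper bounds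
spread to neighbourhoods, and averages never exceed the local essential supremum. Hence `ũ` is the
envelope; it determines `u` because it is a density, and it respects sums and nonnegative multiples
because the averages are linear in `u`. -/

noncomputable section

namespace PPlus

open scoped ContDiff BoundedContinuousFunction

/-! ### Smooth families and differentiation under the integral sign -/

section Families

variable {E T : Type*} [NormedAddCommGroup E] [NormedSpace ℝ E]
  [NormedAddCommGroup T] [NormedSpace ℝ T]

/-- The iterated derivatives in the second variable of a jointly smooth family are jointly
continuous. -/
theorem continuous_iteratedFDeriv_of_uncurry {Ψ : T → E → ℝ}
    (hΨ : ContDiff ℝ ∞ (Function.uncurry Ψ)) (i : ℕ) :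
    Continuous fun p : T × E => iteratedFDeriv ℝ i (Ψ p.1) p.2 := by
  have h : ∀ p : T × E, iteratedFDeriv ℝ i (Ψ p.1) p.2 =
      ContinuousMultilinearMap.compContinuousLinearMapL
        (fun _ : Fin i => ContinuousLinearMap.inr ℝ T E)
        (iteratedFDeriv ℝ i (Function.uncurry Ψ) p) := by
    intro p
    -- A slice of `Ψ` is a translate of the joint function restricted along the linear inclusion of
    -- `E`, so its derivatives are restrictions of the joint ones.
    have h1 : Ψ p.1 =
        (fun z => Function.uncurry Ψ (z + (p.1, 0))) ∘ (ContinuousLinearMap.inr ℝ T E) := by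
      ext x; simp [Function.uncurry]
    have h2 : ContDiff ℝ ∞ (fun z => Function.uncurry Ψ (z + (p.1, 0))) :=
      hΨ.comp (contDiff_id.add contDiff_const)
    rw [h1, ContinuousLinearMap.iteratedFDeriv_comp_right _ h2 _ (by exact_mod_cast le_top),
      iteratedFDeriv_comp_add_right]
    simp [ContinuousMultilinearMap.compContinuousLinearMapL]
  simp_rw [h]
  exact (ContinuousLinearMap.continuous _).comp
    (hΨ.continuous_iteratedFDeriv (by exact_mod_cast le_top))

theorem contDiff_of_uncurry {Ψ : T → E → ℝ} (hΨ : ContDiff ℝ ∞ (Function.uncurry Ψ)) (t : T) :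
    ContDiff ℝ ∞ (Ψ t) :=
  hΨ.comp (contDiff_const.prodMk contDiff_id)

variable [MeasurableSpace T] [BorelSpace T] {μ : Measure T} [IsFiniteMeasureOnCompacts μ]
  [FiniteDimensional ℝ E]

/-- Differentiation under the integral sign, to all orders. -/
theorem hasFTaylorSeriesUpTo_setIntegral {Ψ : T → E → ℝ}
    (hΨ : ContDiff ℝ ∞ (Function.uncurry Ψ)) {S : Set T} (hS : IsCompact S) :
    HasFTaylorSeriesUpTo ∞ (fun x => ∫ t in S, Ψ t x ∂μ)
      (fun x i => ∫ t in S, iteratedFDeriv ℝ i (Ψ t) x ∂μ) := by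
  have hint : ∀ i x, IntegrableOn (fun t => iteratedFDeriv ℝ i (Ψ t) x) S μ := fun i x =>
    ((continuous_iteratedFDeriv_of_uncurry hΨ i).comp
      (Continuous.prodMk_left x)).continuousOn.integrableOn_compact hS
  have hder : ∀ (m : ℕ) (x : E), HasFDerivAt (fun y => ∫ t in S, iteratedFDeriv ℝ m (Ψ t) y ∂μ)
      ((∫ t in S, iteratedFDeriv ℝ (m + 1) (Ψ t) x ∂μ).curryLeft) x := by
    intro m x
    -- On the compact set `S × closedBall x 1` the next derivative is bounded, and this constant
    -- dominates the integrands.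
    obtain ⟨C, hC⟩ := (hS.prod (isCompact_closedBall x 1)).exists_bound_of_continuousOn
      (continuous_iteratedFDeriv_of_uncurry hΨ (m + 1)).continuousOn
    let curryL : (E [×(m + 1)]→L[ℝ] ℝ) →L[ℝ] (E →L[ℝ] (E [×m]→L[ℝ] ℝ)) :=
      (continuousMultilinearCurryLeftEquiv ℝ (fun _ : Fin (m + 1) => E)
        ℝ).toContinuousLinearEquiv.toContinuousLinearMap
    have hcurry : (∫ t in S, iteratedFDeriv ℝ (m + 1) (Ψ t) x ∂μ).curryLeft =
        ∫ t in S, (iteratedFDeriv ℝ (m + 1) (Ψ t) x).curryLeft ∂μ := by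
      exact (ContinuousLinearMap.integral_comp_comm (𝕜 := ℝ)
        (Fₗ := E →L[ℝ] (E [×m]→L[ℝ] ℝ)) curryL (hint (m + 1) x)).symm
    rw [hcurry]
    have hfd : ∀ t y, HasFDerivAt (iteratedFDeriv ℝ m (Ψ t))
        ((iteratedFDeriv ℝ (m + 1) (Ψ t) y).curryLeft) y := by
      intro t y
      have := ((contDiff_of_uncurry hΨ t).ftaylorSeries).fderiv m
        (by exact_mod_cast WithTop.coe_lt_top _) y
      exact this
    refine hasFDerivAt_integral_of_dominated_of_fderiv_le (bound := fun _ => C)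
      (F' := fun y t => (iteratedFDeriv ℝ (m + 1) (Ψ t) y).curryLeft)
      (Metric.closedBall_mem_nhds x one_pos) (Filter.Eventually.of_forall fun y =>
        (hint m y).aestronglyMeasurable) (hint m x) ?_ ?_ ?_ ?_
    · exact ((((continuousMultilinearCurryLeftEquiv ℝ (fun _ : Fin (m + 1) => E)
          ℝ).continuous.comp ((continuous_iteratedFDeriv_of_uncurry hΨ (m + 1)).comp
        (Continuous.prodMk_left x))).continuousOn).integrableOn_compact hS).aestronglyMeasurable
    · filter_upwards [ae_restrict_mem hS.measurableSet] with t ht y hy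
      refine le_trans (le_of_eq ?_) (hC (t, y) ⟨ht, hy⟩)
      exact (continuousMultilinearCurryLeftEquiv ℝ (fun _ : Fin (m + 1) => E) ℝ).norm_map _
    · exact integrableOn_const hS.measure_ne_top
    · exact Filter.Eventually.of_forall fun t y _ => hfd t y
  refine ⟨fun x => ?_, fun m _ x => hder m x, fun m _ => ?_⟩
  · refine ((ContinuousMultilinearMap.apply ℝ (fun _ : Fin 0 => E) ℝ 0).integral_comp_comm
      (hint 0 x)).symm.trans ?_
    simp
  · exact continuous_iff_continuousAt.2 fun x => (hder m x).continuousAt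

end Families

/-! ### Distributions applied to parameter integrals -/

section Evaluation

variable {E : Type*} [NormedAddCommGroup E] [NormedSpace ℝ E] {X : Opens E}

/-- Unbundled test functions on `X`. -/
structure IsTest (X : Opens E) (f : E → ℝ) : Prop where
  contDiff : ContDiff ℝ ∞ f
  hasCompactSupport : HasCompactSupport f
  tsupport_subset : tsupport f ⊆ X

/-- The test function bundling `f`. -/
def IsTest.bundle {f : E → ℝ} (h : IsTest X f) : 𝓓(X, ℝ) :=
  ⟨f, h.contDiff, h.hasCompactSupport, h.tsupport_subset⟩

theorem IsTest.coe_bundle {f : E → ℝ} (h : IsTest X f) : ⇑h.bundle = f := rfl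

theorem isTest_coe (φ : 𝓓(X, ℝ)) : IsTest X φ :=
  ⟨φ.contDiff, φ.hasCompactSupport, φ.tsupport_subset⟩

theorem isTest_of_eq_zero {f : E → ℝ} (hf : ContDiff ℝ ∞ f) {K : Set E} (hK : IsCompact K)
    (hKX : K ⊆ X) (h0 : ∀ x ∉ K, f x = 0) : IsTest X f where
  contDiff := hf
  hasCompactSupport := HasCompactSupport.intro hK h0
  tsupport_subset := (closure_minimal (fun x (hx : f x ≠ 0) => by_contra fun h => hx (h0 x h))
    hK.isClosed).trans hKX

theorem IsTest.add {f g : E → ℝ} (hf : IsTest X f) (hg : IsTest X g) :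
    IsTest X (fun x => f x + g x) := isTest_coe (hf.bundle + hg.bundle)

theorem IsTest.sub {f g : E → ℝ} (hf : IsTest X f) (hg : IsTest X g) :
    IsTest X (fun x => f x - g x) := isTest_coe (hf.bundle - hg.bundle)

theorem IsTest.const_mul {f : E → ℝ} (hf : IsTest X f) (c : ℝ) :
    IsTest X (fun x => c * f x) := isTest_coe (c • hf.bundle)

open Classical in
/-- Evaluation of a distribution at an unbundled test function. -/
def ev (u : 𝓓'(X, ℝ)) (f : E → ℝ) : ℝ := if h : IsTest X f then u h.bundle else 0

theorem IsTest.ev_eq {f : E → ℝ} (h : IsTest X f) (u : 𝓓'(X, ℝ)) : ev u f = u h.bundle := dif_pos h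

theorem ev_coe (u : 𝓓'(X, ℝ)) (φ : 𝓓(X, ℝ)) : ev u φ = u φ := dif_pos (isTest_coe φ)

theorem ev_add_fun (u : 𝓓'(X, ℝ)) {f g : E → ℝ} (hf : IsTest X f) (hg : IsTest X g) :
    ev u (fun x => f x + g x) = ev u f + ev u g := by
  rw [(hf.add hg).ev_eq, hf.ev_eq, hg.ev_eq, ← map_add]; rfl

theorem ev_sub_fun (u : 𝓓'(X, ℝ)) {f g : E → ℝ} (hf : IsTest X f) (hg : IsTest X g) :
    ev u (fun x => f x - g x) = ev u f - ev u g := by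
  rw [(hf.sub hg).ev_eq, hf.ev_eq, hg.ev_eq, ← map_sub]; rfl

theorem ev_const_mul (u : 𝓓'(X, ℝ)) {f : E → ℝ} (hf : IsTest X f) (c : ℝ) :
    ev u (fun x => c * f x) = c * ev u f := by
  rw [(hf.const_mul c).ev_eq, hf.ev_eq, ← smul_eq_mul, ← map_smul]; rfl

theorem ev_smul_add_smul (u v : 𝓓'(X, ℝ)) (a b : ℝ) (f : E → ℝ) :
    ev (a • u + b • v) f = a * ev u f + b * ev v f := by
  by_cases h : IsTest X f
  · simp [h.ev_eq]
  · simp [ev, h]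

variable (E) in
/-- Bounded continuous functions with values in the `i`-linear forms. -/
def JetFun (i : ℕ) : Type _ := E →ᵇ (E [×i]→L[ℝ] ℝ)

instance (i : ℕ) : NormedAddCommGroup (JetFun E i) :=
  inferInstanceAs (NormedAddCommGroup (E →ᵇ (E [×i]→L[ℝ] ℝ)))

instance (i : ℕ) : NormedSpace ℝ (JetFun E i) :=
  inferInstanceAs (NormedSpace ℝ (E →ᵇ (E [×i]→L[ℝ] ℝ)))

instance (i : ℕ) : CompleteSpace (JetFun E i) :=
  inferInstanceAs (CompleteSpace (E →ᵇ (E [×i]→L[ℝ] ℝ)))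

/-- Evaluation at a point. -/
def JetFun.evalL (i : ℕ) (x : E) : JetFun E i →L[ℝ] (E [×i]→L[ℝ] ℝ) :=
  BoundedContinuousFunction.evalCLM ℝ x

theorem JetFun.ext {i : ℕ} {f g : JetFun E i} (h : ∀ x, evalL i x f = evalL i x g) : f = g :=
  BoundedContinuousFunction.ext h

theorem JetFun.dist_le {i : ℕ} {f g : JetFun E i} {C : ℝ} (hC : 0 ≤ C)
    (h : ∀ x, dist (evalL i x f) (evalL i x g) ≤ C) : dist f g ≤ C :=
  (BoundedContinuousFunction.dist_le hC).2 h

/-- The jet of order `N` of a smooth function supported in `K`, in a Banach space. -/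
def jet (K : Compacts E) (N : ℕ) :
    𝓓_{K}(E, ℝ) →ₗ[ℝ] ((i : Fin (N + 1)) → JetFun E i) :=
  LinearMap.pi fun i =>
    (ContDiffMapSupportedIn.structureMapLM ℝ ⊤ (i : ℕ) : 𝓓_{K}(E, ℝ) →ₗ[ℝ] JetFun E i)

theorem jet_apply (K : Compacts E) (N : ℕ) (f : 𝓓_{K}(E, ℝ)) (i : Fin (N + 1)) (x : E) :
    JetFun.evalL i x (jet K N f i) = iteratedFDeriv ℝ i f x :=
  congrFun (ContDiffMapSupportedIn.structureMapLM_top_apply ℝ f) x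

/-- Locally, a distribution is a continuous functional of a jet of finite order. -/
theorem exists_jet_factorization (u : 𝓓'(X, ℝ)) (K : Compacts E) (hK : (K : Set E) ⊆ X) :
    ∃ (N : ℕ) (Λ : ((i : Fin (N + 1)) → JetFun E i) →L[ℝ] ℝ),
      ∀ f : 𝓓_{K}(E, ℝ), u (TestFunction.ofSupportedIn hK f) = Λ (jet K N f) := by
  let v : 𝓓_{K}(E, ℝ) →ₗ[ℝ] ℝ :=
    { toFun := fun f => u (TestFunction.ofSupportedIn hK f)
      map_add' := fun f g => map_add u (TestFunction.ofSupportedIn hK f)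
        (TestFunction.ofSupportedIn hK g)
      map_smul' := fun c f => map_smul u c (TestFunction.ofSupportedIn hK f) }
  have hv : Continuous v := u.continuous.comp (TestFunction.continuous_ofSupportedIn hK)
  obtain ⟨s, C, -, hC⟩ := Seminorm.bound_of_continuous
    (ContDiffMapSupportedIn.withSeminorms ℝ E ℝ ⊤ K) ((normSeminorm ℝ ℝ).comp v)
    (continuous_norm.comp hv)
  obtain ⟨N, hN⟩ : ∃ N, ∀ i ∈ s, i ≤ N := ⟨s.sup id, fun i hi => Finset.le_sup (f := id) hi⟩
  have hbound : ∀ f, ‖v f‖ ≤ C * ‖jet K N f‖ := by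
    intro f
    refine (hC f).trans ?_
    rw [smul_apply]
    refine mul_le_mul_of_nonneg_left ?_ C.2
    refine Seminorm.finset_sup_apply_le (norm_nonneg _) fun i hi => ?_
    exact norm_le_pi_norm (jet K N f) ⟨i, Nat.lt_succ_of_le (hN i hi)⟩
  -- The order-zero component already recovers the function, so `u` descends to a bounded functional
  -- on the range of `jet K N`; Hahn–Banach extends it to the whole Banach space.
  have hinj : Function.Injective (jet K N) := fun f g hfg =>
    ContDiffMapSupportedIn.structureMapLM_zero_injective ℝ (congrFun hfg 0)
  let e := LinearEquiv.ofInjective (jet K N) hinj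
  let w : (LinearMap.range (jet K N)) →L[ℝ] ℝ :=
    LinearMap.mkContinuous (v ∘ₗ e.symm.toLinearMap) C fun x => by
      have := hbound (e.symm x)
      have h2 : jet K N (e.symm x) = x := congrArg Subtype.val (e.apply_symm_apply x)
      rw [h2] at this
      exact this
  obtain ⟨Λ, hΛ, -⟩ := exists_extension_norm_eq _ w
  refine ⟨N, Λ, fun f => ?_⟩
  have := hΛ (e f)
  rw [show ((e f : LinearMap.range (jet K N)) : (i : Fin (N + 1)) → JetFun E i)
    = jet K N f from rfl] at this
  rw [this]
  change v f = v (e.symm (e f))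
  rw [e.symm_apply_apply]

variable [FiniteDimensional ℝ E]
  {T : Type*} [NormedAddCommGroup T] [NormedSpace ℝ T] [MeasurableSpace T] [BorelSpace T]
  {μ : Measure T} [IsFiniteMeasureOnCompacts μ]

/-- A distribution commutes with the integral of a smooth family of test functions over a compact
parameter set, and depends continuously on the parameter. -/
theorem ev_setIntegral (u : 𝓓'(X, ℝ)) {Ψ : T → E → ℝ}
    (hΨ : ContDiff ℝ ∞ (Function.uncurry Ψ)) {S : Set T} (hS : IsCompact S) {K : Set E}
    (hK : IsCompact K) (hKX : K ⊆ X) (h0 : ∀ t ∈ S, ∀ x ∉ K, Ψ t x = 0) :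
    IsTest X (fun x => ∫ t in S, Ψ t x ∂μ) ∧ ContinuousOn (fun t => ev u (Ψ t)) S ∧
      ev u (fun x => ∫ t in S, Ψ t x ∂μ) = ∫ t in S, ev u (Ψ t) ∂μ := by
  classical
  let K' : Compacts E := ⟨K, hK⟩
  have hsm := contDiff_of_uncurry hΨ
  have htay := hasFTaylorSeriesUpTo_setIntegral (μ := μ) hΨ hS
  have hint0 : ∀ x ∉ K, ∫ t in S, Ψ t x ∂μ = 0 := fun x hx => by
    rw [setIntegral_congr_fun hS.measurableSet (g := fun _ => (0 : ℝ)) (fun t ht => h0 t ht x hx)]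
    simp
  have hTheta : IsTest X (fun x => ∫ t in S, Ψ t x ∂μ) :=
    isTest_of_eq_zero htay.contDiff hK hKX hint0
  let θ : 𝓓_{K'}(E, ℝ) := ⟨_, htay.contDiff, fun x hx => hint0 x hx⟩
  -- The support condition is known only for parameters in `S`; elsewhere zero is a default.
  let ψ : T → 𝓓_{K'}(E, ℝ) := fun t => if ht : t ∈ S then ⟨Ψ t, hsm t, fun x hx => h0 t ht x hx⟩
    else 0
  have hψ : ∀ t ∈ S, ⇑(ψ t) = Ψ t := fun t ht => by simp only [ψ, dif_pos ht]; rfl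
  have htest : ∀ t ∈ S, IsTest X (Ψ t) := fun t ht => isTest_of_eq_zero (hsm t) hK hKX (h0 t ht)
  obtain ⟨N, Λ, hΛ⟩ := exists_jet_factorization u K' hKX
  have hevψ : ∀ t ∈ S, ev u (Ψ t) = Λ (jet K' N (ψ t)) := fun t ht => by
    rw [← hΛ, (htest t ht).ev_eq]
    congr 1
    ext x
    exact (congrFun (hψ t ht) x).symm
  have hevθ : ev u (fun x => ∫ t in S, Ψ t x ∂μ) = Λ (jet K' N θ) := by
    rw [← hΛ, hTheta.ev_eq]; rfl
  have hcont : ContinuousOn (fun t => jet K' N (ψ t)) S := by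
    refine continuousOn_pi.2 fun i => ?_
    intro t ht
    rw [ContinuousWithinAt, Metric.tendsto_nhds]
    intro ε hε
    obtain ⟨V, hV, hVS⟩ := hK.mem_uniformity_of_prod
      (f := fun (t : T) (x : E) => iteratedFDeriv ℝ i (Ψ t) x) (s := S)
      (continuous_iteratedFDeriv_of_uncurry hΨ i).continuousOn ht
      (Metric.dist_mem_uniformity (half_pos hε))
    filter_upwards [hV, self_mem_nhdsWithin] with s hs hsS
    refine lt_of_le_of_lt (JetFun.dist_le (half_pos hε).le fun x => ?_)
      (half_lt_self hε)
    rw [jet_apply, jet_apply, hψ s hsS, hψ t ht]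
    by_cases hx : x ∈ K
    · exact (hVS s hs x hx).le
    · have hz : ∀ r ∈ S, iteratedFDeriv ℝ i (Ψ r) x = 0 := fun r hr => by
        rw [← hψ r hr]; exact (ψ r).iteratedFDeriv_zero_on_compl hx
      rw [hz s hsS, hz t ht, dist_self]
      exact (half_pos hε).le
  have hcontev : ContinuousOn (fun t => ev u (Ψ t)) S :=
    (Λ.continuous.comp_continuousOn hcont).congr hevψ
  refine ⟨hTheta, hcontev, ?_⟩
  have hI : IntegrableOn (fun t => jet K' N (ψ t)) S μ := hcont.integrableOn_compact hS
  -- A continuous functional commutes with the Bochner integral of jets; it remains to identify that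
  -- integral with the jet of the integral, which is checked pointwise.
  rw [hevθ, setIntegral_congr_fun hS.measurableSet hevψ, Λ.integral_comp_comm hI]
  congr 1
  ext1 i
  refine JetFun.ext fun x => ?_
  let P : ((i : Fin (N + 1)) → JetFun E i) →L[ℝ] (E [×(i : ℕ)]→L[ℝ] ℝ) :=
    (JetFun.evalL i x).comp (ContinuousLinearMap.proj i)
  have hP := P.integral_comp_comm hI
  change _ = P _
  rw [← hP, jet_apply]
  change iteratedFDeriv ℝ i (fun x => ∫ t in S, Ψ t x ∂μ) x = _
  rw [← htay.eq_iteratedFDeriv (by exact_mod_cast le_top)]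
  refine setIntegral_congr_fun hS.measurableSet fun t ht => ?_
  change _ = JetFun.evalL i x (jet K' N (ψ t) i)
  rw [jet_apply, hψ t ht]

end Evaluation

/-! ### The one-variable profile and its primitive -/

section Profile

/-- A smooth profile, positive on `(-∞, 1)` and zero on `[1, ∞)`. -/
def chi (s : ℝ) : ℝ := expNegInvGlue (1 - s)

/-- Half of the primitive of `chi` that vanishes on `[1, ∞)`, with the sign changed. -/
def phi (t : ℝ) : ℝ := (1 / 2) * ∫ s in t..1, chi s

theorem chi_contDiff : ContDiff ℝ ∞ chi :=
  expNegInvGlue.contDiff.comp (contDiff_const.sub contDiff_id)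

theorem chi_nonneg (s : ℝ) : 0 ≤ chi s := expNegInvGlue.nonneg _

theorem chi_eq_zero {s : ℝ} (hs : 1 ≤ s) : chi s = 0 :=
  expNegInvGlue.zero_of_nonpos (by linarith)

theorem chi_zero_pos : 0 < chi 0 := expNegInvGlue.pos_of_pos (by norm_num)

theorem phi_hasDerivAt (t : ℝ) : HasDerivAt phi (-(1 / 2) * chi t) t := by
  have h := intervalIntegral.integral_hasDerivAt_left (a := t) (b := 1)
    (chi_contDiff.continuous.intervalIntegrable _ _)
    (chi_contDiff.continuous.stronglyMeasurableAtFilter _ _) chi_contDiff.continuous.continuousAt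
  exact (h.const_mul (1 / 2)).congr_deriv (by ring)

theorem phi_contDiff : ContDiff ℝ ∞ phi := by
  rw [contDiff_infty_iff_deriv]
  refine ⟨fun t => (phi_hasDerivAt t).differentiableAt, ?_⟩
  rw [funext fun t => (phi_hasDerivAt t).deriv]
  exact contDiff_const.mul chi_contDiff

theorem phi_eq_zero {t : ℝ} (ht : 1 ≤ t) : phi t = 0 := by
  have : ∫ s in t..1, chi s = ∫ s in t..1, (0 : ℝ) := by
    refine intervalIntegral.integral_congr fun s hs => chi_eq_zero ?_
    rw [uIcc_of_ge ht] at hs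
    exact hs.1
  simp [phi, this]

theorem phi_nonneg (t : ℝ) : 0 ≤ phi t := by
  rcases le_total t 1 with h | h
  · exact mul_nonneg (by norm_num) (intervalIntegral.integral_nonneg h fun s _ => chi_nonneg s)
  · rw [phi_eq_zero h]

theorem deriv_chi_contDiff : ContDiff ℝ ∞ (deriv chi) :=
  (contDiff_infty_iff_deriv.1 chi_contDiff).2

theorem chi_hasDerivAt (s : ℝ) : HasDerivAt chi (deriv chi s) s :=
  ((contDiff_infty_iff_deriv.1 chi_contDiff).1 s).hasDerivAt

end Profile

/-! ### The second order operator on functions of a quadratic form -/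

section Operator

variable {n : ℕ}

/-- The second order operator `∑ᵢⱼ Aᵢⱼ ∂ᵢ ∂ⱼ` on functions. -/
def secondOrder (A : Matrix (Fin n) (Fin n) ℝ) (f : Euc n → ℝ) (x : Euc n) : ℝ :=
  ∑ i, ∑ j, A i j * lineDeriv ℝ (fun y => lineDeriv ℝ f y (EuclideanSpace.single i 1)) x
    (EuclideanSpace.single j 1)

/-- Two derivatives are moved to the test function, and the two signs cancel. -/
theorem hessPairing_apply {X : Opens (Euc n)} (u : 𝓓'(X, ℝ)) (A : SymMat n) (φ : 𝓓(X, ℝ)) :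
    hessPairing u A φ = u (∑ i, ∑ j, A.1 i j •
      ∂_{(EuclideanSpace.single j (1 : ℝ) : Euc n)}
        (∂_{(EuclideanSpace.single i (1 : ℝ) : Euc n)} φ)) := by
  simp only [hessPairing, hess, map_sum, Matrix.of_apply, map_smul]
  have h (T : 𝓓'(X, ℝ)) (i j : Fin n) : (A.1 i j • T) φ = A.1 i j • T φ := rfl
  trans ∑ i, ∑ j, (A.1 i j • ∂_{(EuclideanSpace.single i (1 : ℝ) : Euc n)}
    (∂_{(EuclideanSpace.single j (1 : ℝ) : Euc n)} u)) φ
  · simp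
  · simp [h, Distribution.lineDerivOp_apply_apply]

theorem coe_secondOrder {X : Opens (Euc n)} (A : SymMat n) (φ : 𝓓(X, ℝ)) :
    ⇑(∑ i, ∑ j, A.1 i j • ∂_{(EuclideanSpace.single j (1 : ℝ) : Euc n)}
        (∂_{(EuclideanSpace.single i (1 : ℝ) : Euc n)} φ)) = secondOrder A.1 φ := by
  have h (ψ : 𝓓(X, ℝ)) (v : Euc n) : ⇑((∂_{v} ψ : 𝓓(X, ℝ))) = fun x => lineDeriv ℝ ψ x v := by
    ext x
    rw [TestFunction.lineDerivOp_eq_lineDerivCLM ℝ, TestFunction.lineDerivCLM_apply_of_le]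
    exact le_top
  ext x
  simp [h, secondOrder]

theorem ev_secondOrder_nonneg {P : ProperCone ℝ (SymMat n)} {X : Opens (Euc n)} {u : 𝓓'(X, ℝ)}
    (hu : u ∈ PSHdist P X) {A : SymMat n} (hA : A ∈ polarCone P) {f : Euc n → ℝ}
    (hf : IsTest X f) (h0 : ∀ x, 0 ≤ f x) : 0 ≤ ev u (secondOrder A.1 f) := by
  have h := hu A hA hf.bundle h0
  rwa [hessPairing_apply, ← ev_coe, coe_secondOrder] at h

/-- The bilinear form with matrix `B`. -/
def bil (B : Matrix (Fin n) (Fin n) ℝ) (z w : Euc n) : ℝ := ∑ i, ∑ j, B i j * (z i * w j)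

theorem bil_contDiff (B : Matrix (Fin n) (Fin n) ℝ) : ContDiff ℝ ∞ (fun z : Euc n => bil B z z) := by
  unfold bil
  fun_prop

theorem bil_smul_smul (B : Matrix (Fin n) (Fin n) ℝ) (c : ℝ) (z : Euc n) :
    bil B (c • z) (c • z) = c ^ 2 * bil B z z := by
  simp only [bil, Finset.mul_sum, PiLp.smul_apply, smul_eq_mul]
  exact Finset.sum_congr rfl fun i _ => Finset.sum_congr rfl fun j _ => by ring

theorem bil_comm {B : Matrix (Fin n) (Fin n) ℝ} (hB : B.IsSymm) (z w : Euc n) :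
    bil B z w = bil B w z := by
  rw [bil, bil, Finset.sum_comm]
  exact Finset.sum_congr rfl fun i _ => Finset.sum_congr rfl fun j _ => by
    rw [hB.apply j i]; ring

theorem bil_add_smul_left (B : Matrix (Fin n) (Fin n) ℝ) (z v w : Euc n) (t : ℝ) :
    bil B (z + t • v) w = bil B z w + t * bil B v w := by
  simp only [bil, Finset.mul_sum, ← Finset.sum_add_distrib, PiLp.add_apply, PiLp.smul_apply,
    smul_eq_mul]
  exact Finset.sum_congr rfl fun i _ => Finset.sum_congr rfl fun j _ => by ring

theorem bil_hasLineDerivAt {B : Matrix (Fin n) (Fin n) ℝ} (hB : B.IsSymm) (x y v : Euc n) :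
    HasLineDerivAt ℝ (fun y => bil B (y - x) (y - x)) (2 * bil B (y - x) v) y v := by
  have h : (fun t : ℝ => bil B (y + t • v - x) (y + t • v - x)) =
      fun t => bil B (y - x) (y - x) + t * (2 * bil B (y - x) v) + t ^ 2 * bil B v v := by
    ext t
    rw [add_sub_right_comm, bil_add_smul_left, bil_comm hB _ (y - x + t • v),
      bil_comm hB _ (y - x + t • v), bil_add_smul_left, bil_add_smul_left, bil_comm hB v (y - x)]
    ring
  rw [HasLineDerivAt, h]
  have h1 := (((hasDerivAt_id (0 : ℝ)).mul_const (2 * bil B (y - x) v)).const_add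
    (bil B (y - x) (y - x))).add (((hasDerivAt_id (0 : ℝ)).pow 2).mul_const (bil B v v))
  exact h1.congr_deriv (by simp)

theorem bil_single_hasLineDerivAt (B : Matrix (Fin n) (Fin n) ℝ) (x y v w : Euc n) :
    HasLineDerivAt ℝ (fun y => bil B (y - x) w) (bil B v w) y v := by
  rw [HasLineDerivAt]
  have h : (fun t : ℝ => bil B (y + t • v - x) w) = fun t => bil B (y - x) w + t * bil B v w := by
    ext t
    rw [add_sub_right_comm, bil_add_smul_left]
  rw [h]
  exact (((hasDerivAt_id (0 : ℝ)).mul_const _).const_add _).congr_deriv (by simp)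

theorem bil_single_right (B : Matrix (Fin n) (Fin n) ℝ) (z : Euc n) (i : Fin n) :
    bil B z (EuclideanSpace.single i 1) = ∑ k, B k i * z k := by
  simp [bil]

/-- The operator with matrix `A` acts on functions of the inverse quadratic form by an ordinary
differential operator. -/
theorem secondOrder_comp_bil {A B : Matrix (Fin n) (Fin n) ℝ} (hB : B.IsSymm) (hAB : A * B = 1)
    {F F' F'' : ℝ → ℝ} (hF : ∀ s, HasDerivAt F (F' s) s) (hF' : ∀ s, HasDerivAt F' (F'' s) s)
    (x y : Euc n) :
    secondOrder A (fun y => F (bil B (y - x) (y - x))) y =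
      4 * bil B (y - x) (y - x) * F'' (bil B (y - x) (y - x)) +
        2 * n * F' (bil B (y - x) (y - x)) := by
  have hcomp : ∀ {G G' : ℝ → ℝ} (_ : ∀ s, HasDerivAt G (G' s) s) (y v : Euc n),
      HasLineDerivAt ℝ (fun y => G (bil B (y - x) (y - x)))
        (G' (bil B (y - x) (y - x)) * (2 * bil B (y - x) v)) y v := by
    intro G G' hG y v
    have h1 := bil_hasLineDerivAt hB x y v
    rw [HasLineDerivAt] at h1 ⊢
    have h2 := hG (bil B (y + (0 : ℝ) • v - x) (y + (0 : ℝ) • v - x))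
    have h3 := h2.comp (0 : ℝ) h1
    rwa [zero_smul, add_zero] at h3
  have hfirst : ∀ v, (fun y => lineDeriv ℝ (fun y => F (bil B (y - x) (y - x))) y v) =
      fun y => F' (bil B (y - x) (y - x)) * (2 * bil B (y - x) v) := fun v =>
    funext fun y => (hcomp hF y v).lineDeriv
  have hsecond : ∀ v w, lineDeriv ℝ (fun y => F' (bil B (y - x) (y - x)) * (2 * bil B (y - x) v)) y w
      = F'' (bil B (y - x) (y - x)) * (2 * bil B (y - x) w) * (2 * bil B (y - x) v) +
        F' (bil B (y - x) (y - x)) * (2 * bil B w v) := by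
    intro v w
    have h1 := hcomp hF' y w
    have h2 := bil_single_hasLineDerivAt B x y w v
    rw [HasLineDerivAt] at h1 h2
    have h3 := h1.mul (h2.const_mul 2)
    have h4 : HasLineDerivAt ℝ (fun y => F' (bil B (y - x) (y - x)) * (2 * bil B (y - x) v)) _ y w :=
      h3
    rw [h4.lineDeriv]
    simp
  set z := y - x
  set e : Fin n → Euc n := fun i => EuclideanSpace.single i 1
  -- The coefficient of `F''`: since `A` inverts `B`, `(Bz)ᵀ A (Bz) = zᵀ B z`.
  have h1 : ∑ i, ∑ j, A i j * (bil B z (e i) * bil B z (e j)) = bil B z z := by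
    have hin : ∀ i, ∑ j, A i j * bil B z (e j) = z i := by
      intro i
      have : ∀ j, bil B z (e j) = ∑ k, B j k * z k := fun j => by
        rw [bil_single_right]
        exact Finset.sum_congr rfl fun k _ => by rw [hB.apply]
      simp_rw [this, Finset.mul_sum]
      rw [Finset.sum_comm]
      simp_rw [← mul_assoc, ← Finset.sum_mul]
      have h2 : ∀ k, ∑ j, A i j * B j k = (1 : Matrix (Fin n) (Fin n) ℝ) i k := fun k => by
        rw [← hAB, Matrix.mul_apply]
      simp [h2, Matrix.one_apply]
    calc ∑ i, ∑ j, A i j * (bil B z (e i) * bil B z (e j))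
        = ∑ i, bil B z (e i) * ∑ j, A i j * bil B z (e j) := by
          refine Finset.sum_congr rfl fun i _ => ?_
          rw [Finset.mul_sum]
          exact Finset.sum_congr rfl fun j _ => by ring
      _ = ∑ i, (∑ k, B k i * z k) * z i := by simp_rw [hin, e, bil_single_right]
      _ = bil B z z := by
          rw [bil, Finset.sum_comm]
          simp_rw [Finset.sum_mul]
          exact Finset.sum_congr rfl fun i _ => Finset.sum_congr rfl fun j _ => by ring
  -- The coefficient of `F'`: the trace of `A * B = 1`.
  have h2 : ∑ i, ∑ j, A i j * bil B (e j) (e i) = n := by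
    have : ∀ i, ∑ j, A i j * bil B (e j) (e i) = (1 : Matrix (Fin n) (Fin n) ℝ) i i := fun i => by
      rw [← hAB, Matrix.mul_apply]
      exact Finset.sum_congr rfl fun j _ => by simp [e, bil_single_right]
    simp_rw [this]
    simp
  calc secondOrder A (fun y => F (bil B (y - x) (y - x))) y
      = ∑ i, ∑ j, (4 * F'' (bil B z z) * (A i j * (bil B z (e i) * bil B z (e j))) +
        2 * F' (bil B z z) * (A i j * bil B (e j) (e i))) := by
        unfold secondOrder
        refine Finset.sum_congr rfl fun i _ => Finset.sum_congr rfl fun j _ => ?_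
        rw [hfirst, hsecond]
        ring
    _ = _ := by
        simp_rw [Finset.sum_add_distrib, ← Finset.mul_sum]
        rw [h1, h2]; ring

end Operator

/-! ### The averaging kernels and their potentials -/

section Kernel

variable {n : ℕ}

/-- The total mass of `chi` composed with the quadratic form. -/
def mass (B : Matrix (Fin n) (Fin n) ℝ) : ℝ := ∫ z : Euc n, chi (bil B z z)

/-- The averaging kernel at the scale `e ^ τ`. -/
def ker (B : Matrix (Fin n) (Fin n) ℝ) (τ : ℝ) (z : Euc n) : ℝ :=
  (mass B)⁻¹ * (Real.exp (-n * τ) * chi (Real.exp (-2 * τ) * bil B z z))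

/-- The derivative of the averaging kernel in the logarithm of the scale. -/
def kerDeriv (B : Matrix (Fin n) (Fin n) ℝ) (τ : ℝ) (z : Euc n) : ℝ :=
  (mass B)⁻¹ * (Real.exp (-n * τ) * (-n * chi (Real.exp (-2 * τ) * bil B z z) -
    2 * (Real.exp (-2 * τ) * bil B z z) * deriv chi (Real.exp (-2 * τ) * bil B z z)))

/-- A potential of the derivative of the averaging kernel. -/
def pot (B : Matrix (Fin n) (Fin n) ℝ) (τ : ℝ) (z : Euc n) : ℝ :=
  (mass B)⁻¹ * (Real.exp (-n * τ) * Real.exp (2 * τ) * phi (Real.exp (-2 * τ) * bil B z z))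

variable {A B : Matrix (Fin n) (Fin n) ℝ}

theorem contDiff_ker (B : Matrix (Fin n) (Fin n) ℝ) :
    ContDiff ℝ ∞ (fun p : ℝ × Euc n => ker B p.1 p.2) := by
  have h1 : ContDiff ℝ ∞ (fun p : ℝ × Euc n => Real.exp (-2 * p.1) * bil B p.2 p.2) :=
    (Real.contDiff_exp.comp (contDiff_const.mul contDiff_fst)).mul
      ((bil_contDiff B).comp contDiff_snd)
  exact contDiff_const.mul ((Real.contDiff_exp.comp (contDiff_const.mul contDiff_fst)).mul
    (chi_contDiff.comp h1))

theorem contDiff_kerDeriv (B : Matrix (Fin n) (Fin n) ℝ) :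
    ContDiff ℝ ∞ (fun p : ℝ × Euc n => kerDeriv B p.1 p.2) := by
  have h1 : ContDiff ℝ ∞ (fun p : ℝ × Euc n => Real.exp (-2 * p.1) * bil B p.2 p.2) :=
    (Real.contDiff_exp.comp (contDiff_const.mul contDiff_fst)).mul
      ((bil_contDiff B).comp contDiff_snd)
  exact contDiff_const.mul ((Real.contDiff_exp.comp (contDiff_const.mul contDiff_fst)).mul
    ((contDiff_const.mul (chi_contDiff.comp h1)).sub
      ((contDiff_const.mul h1).mul (deriv_chi_contDiff.comp h1))))

theorem contDiff_pot (B : Matrix (Fin n) (Fin n) ℝ) (τ : ℝ) : ContDiff ℝ ∞ (pot B τ) :=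
  contDiff_const.mul (contDiff_const.mul (phi_contDiff.comp (contDiff_const.mul (bil_contDiff B))))

theorem ker_hasDerivAt (B : Matrix (Fin n) (Fin n) ℝ) (τ : ℝ) (z : Euc n) :
    HasDerivAt (fun τ => ker B τ z) (kerDeriv B τ z) τ := by
  have h1 : ∀ c : ℝ, HasDerivAt (fun τ => Real.exp (c * τ)) (Real.exp (c * τ) * c) τ := fun c =>
    ((hasDerivAt_id τ).const_mul c).exp.congr_deriv (by simp)
  have h2 := (chi_hasDerivAt (Real.exp (-2 * τ) * bil B z z)).comp τ ((h1 (-2)).mul_const _)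
  refine (((h1 (-n)).mul h2).const_mul _).congr_deriv ?_
  simp only [kerDeriv, Function.comp]
  ring

/-- The identity behind monotonicity. On a function `F` of `Q` the operator is `4 Q F'' + 2 n F'`,
and `phi' = -chi / 2` turns this into exactly the derivative of the kernel in `τ`. The factor
`e^{2τ}` in `pot` compensates the inner scaling `e^{-2τ}`. -/
theorem secondOrder_pot (hB : B.IsSymm) (hAB : A * B = 1) (τ : ℝ) (x y : Euc n) :
    secondOrder A (fun y => pot B τ (y - x)) y = kerDeriv B τ (y - x) := by
  set k := Real.exp (-2 * τ)
  have hk : Real.exp (2 * τ) * k = 1 := by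
    rw [← Real.exp_add]; simp
  have hlin : ∀ s, HasDerivAt (fun s : ℝ => k * s) k s := fun s => by
    simpa using (hasDerivAt_id s).const_mul k
  have hF : ∀ s, HasDerivAt
      (fun s => (mass B)⁻¹ * (Real.exp (-n * τ) * Real.exp (2 * τ) * phi (k * s)))
      ((mass B)⁻¹ * (Real.exp (-n * τ) * (-(1 / 2) * chi (k * s)))) s := fun s => by
    refine ((((phi_hasDerivAt (k * s)).comp s (hlin s)).const_mul _).const_mul _).congr_deriv ?_
    linear_combination (mass B)⁻¹ * Real.exp (-n * τ) * (-(1 / 2) * chi (k * s)) * hk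
  have hF' : ∀ s, HasDerivAt
      (fun s => (mass B)⁻¹ * (Real.exp (-n * τ) * (-(1 / 2) * chi (k * s))))
      ((mass B)⁻¹ * (Real.exp (-n * τ) * (-(1 / 2) * (deriv chi (k * s) * k)))) s := fun s =>
    ((((chi_hasDerivAt (k * s)).comp s (hlin s)).const_mul _).const_mul _).const_mul _
  have h := secondOrder_comp_bil hB hAB hF hF' x y
  refine h.trans ?_
  rw [kerDeriv]
  ring

/-- The normalization of `B` places the supports of all kernels in Euclidean balls of radius `e^τ`.
-/
theorem one_le_of_norm (hB : ∀ z : Euc n, ‖z‖ ^ 2 ≤ bil B z z)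
    {τ : ℝ} {z : Euc n} (hz : z ∉ Metric.closedBall (0 : Euc n) (Real.exp τ)) :
    1 ≤ Real.exp (-2 * τ) * bil B z z := by
  rw [mem_closedBall_zero_iff, not_le] at hz
  have h1 : Real.exp τ ^ 2 ≤ bil B z z :=
    (pow_le_pow_left₀ (Real.exp_pos τ).le hz.le 2).trans (hB z)
  have h2 : Real.exp (-2 * τ) * Real.exp τ ^ 2 = 1 := by
    rw [← Real.exp_nat_mul, ← Real.exp_add]; simp
  rw [← h2]
  exact mul_le_mul_of_nonneg_left h1 (Real.exp_pos _).le

theorem ker_eq_zero (hB : ∀ z : Euc n, ‖z‖ ^ 2 ≤ bil B z z)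
    {τ : ℝ} {z : Euc n} (hz : z ∉ Metric.closedBall (0 : Euc n) (Real.exp τ)) :
    ker B τ z = 0 := by
  rw [ker, chi_eq_zero (one_le_of_norm hB hz), mul_zero, mul_zero]

theorem pot_eq_zero (hB : ∀ z : Euc n, ‖z‖ ^ 2 ≤ bil B z z)
    {τ : ℝ} {z : Euc n} (hz : z ∉ Metric.closedBall (0 : Euc n) (Real.exp τ)) :
    pot B τ z = 0 := by
  rw [pot, phi_eq_zero (one_le_of_norm hB hz), mul_zero, mul_zero]

theorem mass_pos (hB : ∀ z : Euc n, ‖z‖ ^ 2 ≤ bil B z z) : 0 < mass B := by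
  have hc : Continuous fun z : Euc n => chi (bil B z z) :=
    chi_contDiff.continuous.comp (bil_contDiff B).continuous
  refine hc.integral_pos_of_hasCompactSupport_nonneg_nonzero
    (HasCompactSupport.intro (isCompact_closedBall (0 : Euc n) (Real.exp 0)) fun z hz =>
      chi_eq_zero (by simpa using one_le_of_norm hB hz)) (fun z => chi_nonneg _) (x := 0) ?_
  have : bil B (0 : Euc n) 0 = 0 := by simp [bil]
  simp only [this]
  exact chi_zero_pos.ne'

theorem ker_nonneg (hB : ∀ z : Euc n, ‖z‖ ^ 2 ≤ bil B z z) (τ : ℝ) (z : Euc n) : 0 ≤ ker B τ z :=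
  mul_nonneg (inv_nonneg.2 (mass_pos hB).le) (mul_nonneg (Real.exp_pos _).le (chi_nonneg _))

theorem pot_nonneg (hB : ∀ z : Euc n, ‖z‖ ^ 2 ≤ bil B z z) (τ : ℝ) (z : Euc n) : 0 ≤ pot B τ z :=
  mul_nonneg (inv_nonneg.2 (mass_pos hB).le) (mul_nonneg (by positivity) (phi_nonneg _))

/-- The substitution `z ↦ e^{-τ} z` produces the factor `e^{nτ}`, which the prefactor `e^{-nτ}`
cancels. -/
theorem integral_ker (hB : ∀ z : Euc n, ‖z‖ ^ 2 ≤ bil B z z) (τ : ℝ) : ∫ z, ker B τ z = 1 := by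
  have h := Measure.integral_comp_smul (volume : Measure (Euc n)) (fun z => chi (bil B z z))
    (Real.exp (-τ))
  simp only [ker, integral_const_mul]
  have h2 : ∀ z : Euc n, chi (Real.exp (-2 * τ) * bil B z z) =
      chi (bil B (Real.exp (-τ) • z) (Real.exp (-τ) • z)) := fun z => by
    rw [bil_smul_smul, ← Real.exp_nat_mul]; congr 3; push_cast; ring_nf
  simp_rw [h2, h, finrank_euclideanSpace, Fintype.card_fin]
  rw [← Real.exp_nat_mul, ← Real.exp_neg, abs_of_pos (Real.exp_pos _), smul_eq_mul, ← mul_assoc,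
    ← mul_assoc, mul_assoc (mass B)⁻¹, ← Real.exp_add]
  have h3 : -(n : ℝ) * τ + -(n * -τ) = 0 := by ring
  rw [h3, Real.exp_zero, mul_one]
  exact inv_mul_cancel₀ (mass_pos hB).ne'

end Kernel

/-! ### Averages of a distribution: monotonicity and convergence -/

section Regularization

variable {n : ℕ} {X : Opens (Euc n)} {A B : Matrix (Fin n) (Fin n) ℝ}

theorem exists_closedBall_add_subset {x : Euc n} {r : ℝ} (hr : 0 ≤ r)
    (h : Metric.closedBall x r ⊆ X) : ∃ δ > 0, Metric.closedBall x (r + δ) ⊆ X := by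
  obtain ⟨δ, hδ, hsub⟩ := (isCompact_closedBall x r).exists_cthickening_subset_open X.isOpen h
  rw [cthickening_closedBall hδ.le hr, add_comm] at hsub
  exact ⟨δ, hδ, hsub⟩

theorem kerDeriv_eq_zero (hB : ∀ z : Euc n, ‖z‖ ^ 2 ≤ bil B z z) {τ : ℝ} {z : Euc n}
    (hz : z ∉ Metric.closedBall (0 : Euc n) (Real.exp τ)) : kerDeriv B τ z = 0 := by
  have h1 := one_le_of_norm hB hz
  -- The zeros of the nonnegative function `chi` are minima, which covers the boundary point `1` as
  -- well.
  have h2 : deriv chi (Real.exp (-2 * τ) * bil B z z) = 0 :=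
    IsLocalMin.deriv_eq_zero (Filter.Eventually.of_forall fun s => by
      rw [chi_eq_zero h1]; exact chi_nonneg s)
  rw [kerDeriv, h2, chi_eq_zero h1]
  ring

theorem sub_notMem_closedBall {x y : Euc n} {r : ℝ} (h : y ∉ Metric.closedBall x r) :
    y - x ∉ Metric.closedBall (0 : Euc n) r := by
  rwa [mem_closedBall_zero_iff, ← dist_eq_norm, ← Metric.mem_closedBall]

/-- The average of a distribution at the scale `e ^ τ` around the point `x`. -/
def reg (B : Matrix (Fin n) (Fin n) ℝ) (u : 𝓓'(X, ℝ)) (τ : ℝ) (x : Euc n) : ℝ :=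
  ev u (fun y => ker B τ (y - x))

theorem contDiff_ker_sub (B : Matrix (Fin n) (Fin n) ℝ) (τ : ℝ) :
    ContDiff ℝ ∞ (fun p : Euc n × Euc n => ker B τ (p.2 - p.1)) :=
  (contDiff_ker B).comp (contDiff_const.prodMk (contDiff_snd.sub contDiff_fst))

theorem isTest_ker (hB : ∀ z : Euc n, ‖z‖ ^ 2 ≤ bil B z z) {τ : ℝ} {x : Euc n}
    (hx : Metric.closedBall x (Real.exp τ) ⊆ X) : IsTest X (fun y => ker B τ (y - x)) :=
  isTest_of_eq_zero (contDiff_of_uncurry (Ψ := fun x y => ker B τ (y - x)) (contDiff_ker_sub B τ) x)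
    (isCompact_closedBall x _) hx fun _ hy => ker_eq_zero hB (sub_notMem_closedBall hy)

theorem isTest_pot (hB : ∀ z : Euc n, ‖z‖ ^ 2 ≤ bil B z z) {τ : ℝ} {x : Euc n}
    (hx : Metric.closedBall x (Real.exp τ) ⊆ X) : IsTest X (fun y => pot B τ (y - x)) :=
  isTest_of_eq_zero ((contDiff_pot B τ).comp (contDiff_id.sub contDiff_const))
    (isCompact_closedBall x _) hx fun _ hy => pot_eq_zero hB (sub_notMem_closedBall hy)

/-- The averages of a plurisubharmonic distribution increase with the scale. -/
theorem reg_mono {P : ProperCone ℝ (SymMat n)} {u : 𝓓'(X, ℝ)} (hu : u ∈ PSHdist P X)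
    {A : SymMat n} (hA : A ∈ polarCone P) (hBs : B.IsSymm) (hAB : A.1 * B = 1)
    (hB : ∀ z : Euc n, ‖z‖ ^ 2 ≤ bil B z z) {σ τ : ℝ} (hστ : σ ≤ τ) {x : Euc n}
    (hx : Metric.closedBall x (Real.exp τ) ⊆ X) : reg B u σ x ≤ reg B u τ x := by
  have hball : ∀ t ∈ Icc σ τ, Metric.closedBall x (Real.exp t) ⊆ Metric.closedBall x (Real.exp τ) :=
    fun t ht => Metric.closedBall_subset_closedBall (Real.exp_le_exp.2 ht.2)
  have hσ := isTest_ker hB ((hball σ ⟨le_rfl, hστ⟩).trans hx)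
  have hΨ : ContDiff ℝ ∞ (Function.uncurry fun (t : ℝ) (y : Euc n) => kerDeriv B t (y - x)) :=
    (contDiff_kerDeriv B).comp (contDiff_fst.prodMk (contDiff_snd.sub contDiff_const))
  obtain ⟨-, -, h⟩ := ev_setIntegral (μ := volume) u hΨ (isCompact_Icc (a := σ) (b := τ))
    (isCompact_closedBall x (Real.exp τ)) hx fun t ht y hy =>
      kerDeriv_eq_zero hB (sub_notMem_closedBall fun h => hy (hball t ht h))
  -- The difference of two kernels is the integral over the scale of `kerDeriv`, and `u` may be
  -- applied under that integral.
  have hftc : (fun y => ∫ t in Icc σ τ, kerDeriv B t (y - x)) =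
      fun y => ker B τ (y - x) - ker B σ (y - x) := by
    ext y
    rw [integral_Icc_eq_integral_Ioc, ← intervalIntegral.integral_of_le hστ]
    refine intervalIntegral.integral_eq_sub_of_hasDerivAt (fun t _ => ker_hasDerivAt B t (y - x)) ?_
    exact (hΨ.continuous.comp (Continuous.prodMk_left y)).intervalIntegrable _ _
  have hnn : 0 ≤ ∫ t in Icc σ τ, ev u (fun y => kerDeriv B t (y - x)) := by
    refine setIntegral_nonneg measurableSet_Icc fun t ht => ?_
    -- The integrand is `u` applied to `L` of a nonnegative test function.
    rw [← funext fun y => secondOrder_pot hBs hAB t x y]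
    exact ev_secondOrder_nonneg hu hA (isTest_pot hB ((hball t ht).trans hx))
      fun y => pot_nonneg hB t _
  rw [← h, hftc, ev_sub_fun u (isTest_ker hB hx) hσ] at hnn
  exact sub_nonneg.1 hnn

theorem isOpen_setOf_closedBall_subset {r : ℝ} (hr : 0 ≤ r) :
    IsOpen {x : Euc n | Metric.closedBall x r ⊆ X} := by
  rw [Metric.isOpen_iff]
  intro x hx
  obtain ⟨δ, hδ, hsub⟩ := exists_closedBall_add_subset hr hx
  refine ⟨δ, hδ, fun y hy => (Metric.closedBall_subset_closedBall' ?_).trans hsub⟩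
  linarith [Metric.mem_ball.1 hy]

theorem reg_continuousAt (hB : ∀ z : Euc n, ‖z‖ ^ 2 ≤ bil B z z) (u : 𝓓'(X, ℝ)) {τ : ℝ}
    {x : Euc n} (hx : Metric.closedBall x (Real.exp τ) ⊆ X) : ContinuousAt (reg B u τ) x := by
  obtain ⟨δ, hδ, hsub⟩ := exists_closedBall_add_subset (Real.exp_pos τ).le hx
  obtain ⟨-, h, -⟩ := ev_setIntegral (μ := volume) u
    (Ψ := fun (z : Euc n) (y : Euc n) => ker B τ (y - z)) (contDiff_ker_sub B τ)
    (isCompact_closedBall x δ) (isCompact_closedBall x (Real.exp τ + δ)) hsub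
    fun z hz y hy => ker_eq_zero hB (sub_notMem_closedBall fun h => hy
      (Metric.closedBall_subset_closedBall' (by linarith [Metric.mem_closedBall.1 hz]) h))
  exact h.continuousAt (Metric.closedBall_mem_nhds x hδ)

theorem closedBall_subset_of_cthickening {H : Set (Euc n)} {r : ℝ}
    (hH : Metric.cthickening r H ⊆ X) {x : Euc n} (hx : x ∈ H) : Metric.closedBall x r ⊆ X :=
  (Metric.closedBall_subset_cthickening hx r).trans hH

theorem integrable_mul_reg (hB : ∀ z : Euc n, ‖z‖ ^ 2 ≤ bil B z z) (u : 𝓓'(X, ℝ)) {φ : Euc n → ℝ}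
    (hφ : IsTest X φ) {τ : ℝ} (hτ : Metric.cthickening (Real.exp τ) (tsupport φ) ⊆ X) :
    Integrable (fun x => φ x * reg B u τ x) := by
  rw [← integrableOn_iff_integrable_of_support_subset (s := tsupport φ)]
  · refine ContinuousOn.integrableOn_compact hφ.hasCompactSupport ?_
    exact hφ.contDiff.continuous.continuousOn.mul fun x hx =>
      (reg_continuousAt hB u (closedBall_subset_of_cthickening hτ hx)).continuousWithinAt
  · exact (Function.support_mul_subset_left _ _).trans (subset_tsupport φ)

/-- Both integrals are `u` evaluated at the convolution of `φ` with the kernel, written once with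
the variable in `φ` and once with the variable in the kernel. The second form reduces convergence as
`τ → -∞` to continuity of `h ↦ ev u (φ (· - h))` at zero. -/
theorem integral_mul_reg (hB : ∀ z : Euc n, ‖z‖ ^ 2 ≤ bil B z z) (u : 𝓓'(X, ℝ)) {φ : Euc n → ℝ}
    (hφ : IsTest X φ) {τ : ℝ} (hτ : Metric.cthickening (Real.exp τ) (tsupport φ) ⊆ X) :
    ContinuousOn (fun h => ev u (fun y => φ (y - h))) (Metric.closedBall 0 (Real.exp τ)) ∧
    ∫ x, φ x * reg B u τ x = ∫ h in Metric.closedBall 0 (Real.exp τ),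
      ker B τ h * ev u (fun y => φ (y - h)) := by
  have hH : IsCompact (tsupport φ) := hφ.hasCompactSupport
  have hK := hH.cthickening (r := Real.exp τ)
  have hφ2 : ContDiff ℝ ∞ fun p : Euc n × Euc n => φ (p.2 - p.1) :=
    hφ.contDiff.comp (contDiff_snd.sub contDiff_fst)
  have hshift : ∀ h ∈ Metric.closedBall (0 : Euc n) (Real.exp τ),
      ∀ y ∉ Metric.cthickening (Real.exp τ) (tsupport φ), φ (y - h) = 0 := by
    intro h hh y hy
    refine image_eq_zero_of_notMem_tsupport fun hmem => hy ?_
    refine Metric.closedBall_subset_cthickening hmem _ ?_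
    rw [Metric.mem_closedBall, dist_eq_norm]
    simpa using hh
  obtain ⟨-, -, h1⟩ := ev_setIntegral (μ := volume) u
    (Ψ := fun (x : Euc n) (y : Euc n) => φ x * ker B τ (y - x))
    ((hφ.contDiff.comp contDiff_fst).mul (contDiff_ker_sub B τ)) hH hK hτ
    fun x hx y hy => by
      rw [ker_eq_zero hB (sub_notMem_closedBall fun h =>
        hy (Metric.closedBall_subset_cthickening hx _ h)), mul_zero]
  obtain ⟨-, -, h2⟩ := ev_setIntegral (μ := volume) u
    (Ψ := fun (h : Euc n) (y : Euc n) => ker B τ h * φ (y - h))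
    (((contDiff_ker B).comp (contDiff_const.prodMk contDiff_fst)).mul hφ2)
    (isCompact_closedBall 0 (Real.exp τ)) hK hτ
    fun h hh y hy => by rw [hshift h hh y hy, mul_zero]
  obtain ⟨-, h3, -⟩ := ev_setIntegral (μ := volume) u
    (Ψ := fun (h : Euc n) (y : Euc n) => φ (y - h)) hφ2
    (isCompact_closedBall 0 (Real.exp τ)) hK hτ hshift
  refine ⟨h3, ?_⟩
  have e1 : ∀ y, ∫ x in tsupport φ, φ x * ker B τ (y - x) = ∫ x, φ x * ker B τ (y - x) := fun y =>
    setIntegral_eq_integral_of_forall_compl_eq_zero fun x hx => by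
      rw [image_eq_zero_of_notMem_tsupport hx, zero_mul]
  have e2 : ∀ y, ∫ h in Metric.closedBall 0 (Real.exp τ), ker B τ h * φ (y - h) =
      ∫ h, ker B τ h * φ (y - h) := fun y =>
    setIntegral_eq_integral_of_forall_compl_eq_zero fun h hh => by
      rw [ker_eq_zero hB hh, zero_mul]
  -- The change of variables `h = y - x`.
  have e3 : ∀ y, ∫ x, φ x * ker B τ (y - x) = ∫ h, ker B τ h * φ (y - h) := fun y => by
    rw [← integral_sub_left_eq_self (fun h => ker B τ h * φ (y - h)) volume y]
    simp [mul_comm]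
  rw [funext e1, funext e3, ← funext e2, h2] at h1
  have e4 : ∫ x, φ x * reg B u τ x = ∫ x in tsupport φ, φ x * reg B u τ x :=
    (setIntegral_eq_integral_of_forall_compl_eq_zero fun x hx => by
      rw [image_eq_zero_of_notMem_tsupport hx, zero_mul]).symm
  rw [e4]
  trans ∫ x in tsupport φ, ev u (fun y => φ x * ker B τ (y - x))
  · refine setIntegral_congr_fun hH.measurableSet fun x hx => ?_
    exact (ev_const_mul u (isTest_ker hB (closedBall_subset_of_cthickening hτ hx)) _).symm
  rw [← h1]
  refine setIntegral_congr_fun measurableSet_closedBall fun h hh => ?_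
  refine ev_const_mul u (isTest_of_eq_zero ?_ hK hτ (hshift h hh)) _
  exact hφ2.comp (contDiff_const.prodMk contDiff_id)

theorem exists_cthickening_exp_subset {φ : Euc n → ℝ} (hφ : IsTest X φ) :
    ∃ τ₀ : ℝ, ∀ τ ≤ τ₀, Metric.cthickening (Real.exp τ) (tsupport φ) ⊆ X := by
  obtain ⟨δ, hδ, hsub⟩ := (show IsCompact (tsupport φ) from
    hφ.hasCompactSupport).exists_cthickening_subset_open X.isOpen hφ.tsupport_subset
  refine ⟨Real.log δ, fun τ hτ => (Metric.cthickening_mono ?_ _).trans hsub⟩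
  rwa [← Real.le_log_iff_exp_le hδ]

/-- The averages of a distribution converge to the distribution. -/
theorem tendsto_integral_mul_reg (hB : ∀ z : Euc n, ‖z‖ ^ 2 ≤ bil B z z) (u : 𝓓'(X, ℝ))
    {φ : Euc n → ℝ} (hφ : IsTest X φ) :
    Filter.Tendsto (fun τ => ∫ x, φ x * reg B u τ x) Filter.atBot (𝓝 (ev u φ)) := by
  obtain ⟨τ₀, hτ₀⟩ := exists_cthickening_exp_subset hφ
  set v : Euc n → ℝ := fun h => ev u (fun y => φ (y - h)) with hv
  have hv0 : v 0 = ev u φ := by simp [hv]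
  have hvc := (integral_mul_reg hB u hφ (hτ₀ τ₀ le_rfl)).1
  have hvc0 : ContinuousAt v 0 :=
    hvc.continuousAt (Metric.closedBall_mem_nhds 0 (Real.exp_pos τ₀))
  rw [← hv0, Metric.tendsto_nhds]
  intro ε hε
  obtain ⟨δ, hδ, hvδ⟩ := Metric.continuousAt_iff.1 hvc0 (ε / 2) (half_pos hε)
  filter_upwards [Filter.eventually_le_atBot τ₀, Filter.eventually_lt_atBot (Real.log δ)]
    with τ hτ hτδ
  have hexp : Real.exp τ < δ := by rwa [← Real.lt_log_iff_exp_lt hδ]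
  rw [(integral_mul_reg hB u hφ (hτ₀ τ hτ)).2]
  change dist (∫ h in Metric.closedBall 0 (Real.exp τ), ker B τ h * v h) (v 0) < ε
  have hkc : Continuous (ker B τ) :=
    ((contDiff_ker B).comp (contDiff_const.prodMk contDiff_id)).continuous
  have hk1 : ∫ h in Metric.closedBall 0 (Real.exp τ), ker B τ h = 1 := by
    rw [setIntegral_eq_integral_of_forall_compl_eq_zero fun h hh => ker_eq_zero hB hh,
      integral_ker hB]
  have hki : IntegrableOn (ker B τ) (Metric.closedBall 0 (Real.exp τ)) :=
    hkc.continuousOn.integrableOn_compact (isCompact_closedBall _ _)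
  have hkvi : IntegrableOn (fun h => ker B τ h * v h) (Metric.closedBall 0 (Real.exp τ)) :=
    (hkc.continuousOn.mul (integral_mul_reg hB u hφ (hτ₀ τ hτ)).1).integrableOn_compact
      (isCompact_closedBall _ _)
  -- As the kernel has mass one, the error is an average of `v h - v 0` over a ball shrinking to the
  -- origin.
  have hdiff : (∫ h in Metric.closedBall 0 (Real.exp τ), ker B τ h * v h) - v 0 =
      ∫ h in Metric.closedBall 0 (Real.exp τ), (ker B τ h * v h - ker B τ h * v 0) := by
    rw [integral_sub hkvi (hki.mul_const _), integral_mul_const, hk1, one_mul]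
  rw [Real.dist_eq, hdiff, ← Real.norm_eq_abs]
  have hle : ‖∫ h in Metric.closedBall 0 (Real.exp τ), (ker B τ h * v h - ker B τ h * v 0)‖ ≤
      ∫ h in Metric.closedBall 0 (Real.exp τ), ker B τ h * (ε / 2) := by
    refine norm_integral_le_of_norm_le (hki.mul_const _) ?_
    filter_upwards [ae_restrict_mem measurableSet_closedBall] with h hh
    rw [← mul_sub, norm_mul, Real.norm_of_nonneg (ker_nonneg hB τ h)]
    refine mul_le_mul_of_nonneg_left ?_ (ker_nonneg hB τ h)
    have := hvδ (x := h) (lt_of_le_of_lt (Metric.mem_closedBall.1 hh) hexp)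
    exact this.le
  rw [integral_mul_const, hk1, one_mul] at hle
  linarith

end Regularization

/-! ### Monotone limits of integrable functions -/

section Convergence

variable {α : Type*} [MeasurableSpace α] {μ : Measure α}

/-- A monotone sequence of nonnegative functions with bounded integrals is bounded almost
everywhere. -/
theorem ae_bounded_of_monotone {f : ℕ → α → ℝ} (hf : ∀ k, Integrable (f k) μ)
    (hmono : ∀ x, Monotone fun k => f k x) (h0 : ∀ k x, 0 ≤ f k x) {C : ℝ}
    (hC : ∀ k, ∫ x, f k x ∂μ ≤ C) : ∀ᵐ x ∂μ, ∃ M, ∀ k, f k x ≤ M := by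
  have hm : ∀ k, AEMeasurable (fun x => ENNReal.ofReal (f k x)) μ := fun k =>
    (hf k).aestronglyMeasurable.aemeasurable.ennreal_ofReal
  have hle : ∫⁻ x, ⨆ k, ENNReal.ofReal (f k x) ∂μ ≤ ENNReal.ofReal C := by
    rw [lintegral_iSup' hm (Filter.Eventually.of_forall fun x k l hkl =>
      ENNReal.ofReal_le_ofReal (hmono x hkl))]
    refine iSup_le fun k => ?_
    rw [← ofReal_integral_eq_lintegral_ofReal (hf k) (Filter.Eventually.of_forall (h0 k))]
    exact ENNReal.ofReal_le_ofReal (hC k)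
  filter_upwards [ae_lt_top' (AEMeasurable.iSup hm) (hle.trans_lt ENNReal.ofReal_lt_top).ne]
    with x hx
  refine ⟨(⨆ k, ENNReal.ofReal (f k x)).toReal, fun k => ?_⟩
  rw [← ENNReal.ofReal_le_iff_le_toReal hx.ne]
  exact le_iSup (fun k => ENNReal.ofReal (f k x)) k

/-- **Monotone convergence** with integrability of the limit. -/
theorem integrable_of_monotone {f : ℕ → α → ℝ} (hf : ∀ k, Integrable (f k) μ)
    (h0 : ∀ k x, 0 ≤ f k x) {C : ℝ}
    (hC : ∀ k, ∫ x, f k x ∂μ ≤ C) {F : α → ℝ}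
    (hF : ∀ᵐ x ∂μ, Filter.Tendsto (fun k => f k x) Filter.atTop (𝓝 (F x))) :
    Integrable F μ := by
  refine ⟨aestronglyMeasurable_of_tendsto_ae _ (fun k => (hf k).aestronglyMeasurable) hF, ?_⟩
  rw [hasFiniteIntegral_iff_enorm]
  -- Fatou's lemma.
  have h1 : ∫⁻ x, ‖F x‖ₑ ∂μ ≤ Filter.liminf (fun k => ∫⁻ x, ‖f k x‖ₑ ∂μ) Filter.atTop := by
    refine le_trans (le_of_eq (lintegral_congr_ae ?_))
      (lintegral_liminf_le' fun k => (hf k).aestronglyMeasurable.aemeasurable.enorm)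
    filter_upwards [hF] with x hx using hx.enorm.liminf_eq.symm
  refine h1.trans_lt (lt_of_le_of_lt ?_ (ENNReal.ofReal_lt_top (r := C)))
  refine (Filter.liminf_le_liminf (Filter.Eventually.of_forall fun k => ?_)).trans_eq
    (Filter.liminf_const (ENNReal.ofReal C))
  rw [lintegral_congr fun x => Real.enorm_of_nonneg (h0 k x),
    ← ofReal_integral_eq_lintegral_ofReal (hf k) (Filter.Eventually.of_forall (h0 k))]
  exact ENNReal.ofReal_le_ofReal (hC k)

end Convergence

/-! ### The envelope as density and as essential limsup -/

section Density

variable {n : ℕ} {X : Opens (Euc n)} {B : Matrix (Fin n) (Fin n) ℝ} {u : 𝓓'(X, ℝ)}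

theorem exists_cutoff {s : Set (Euc n)} (hs : IsCompact s) (hsX : s ⊆ X) :
    ∃ η : Euc n → ℝ, IsTest X η ∧ (∀ x, 0 ≤ η x) ∧ ∀ᶠ x in 𝓝ˢ s, η x = 1 := by
  obtain ⟨δ, hδ, hsub⟩ := hs.exists_cthickening_subset_open X.isOpen hsX
  obtain ⟨f, h1, h2, h3⟩ := exists_contMDiffMap_one_nhds_of_subset_interior
    (modelWithCornersSelf ℝ (Euc n)) (n := ⊤) (s := s) (t := Metric.cthickening δ s) hs.isClosed
    ((Metric.self_subset_thickening hδ s).trans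
      (interior_maximal (Metric.thickening_subset_cthickening δ s) Metric.isOpen_thickening))
  exact ⟨f, isTest_of_eq_zero f.contMDiff.contDiff hs.cthickening hsub h2, fun x => (h3 x).1, h1⟩

/-- The limit of the averages of a distribution, as the scale tends to zero. -/
def envelope (B : Matrix (Fin n) (Fin n) ℝ) (u : 𝓓'(X, ℝ)) (x : Euc n) : EReal :=
  ⨅ (τ : ℝ) (_ : Metric.closedBall x (Real.exp τ) ⊆ X), (reg B u τ x : EReal)

/-- The averages of `u` increase with the scale. -/
def RegMono (B : Matrix (Fin n) (Fin n) ℝ) (u : 𝓓'(X, ℝ)) : Prop :=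
  ∀ (x : Euc n) (σ τ : ℝ), σ ≤ τ → Metric.closedBall x (Real.exp τ) ⊆ X →
    reg B u σ x ≤ reg B u τ x

theorem closedBall_exp_subset_of_le {x : Euc n} {σ τ : ℝ} (h : σ ≤ τ)
    (hx : Metric.closedBall x (Real.exp τ) ⊆ X) : Metric.closedBall x (Real.exp σ) ⊆ X :=
  (Metric.closedBall_subset_closedBall (Real.exp_le_exp.2 h)).trans hx

theorem exists_closedBall_exp_subset {x : Euc n} {U : Set (Euc n)} (hU : U ∈ 𝓝 x) :
    ∃ τ : ℝ, Metric.closedBall x (Real.exp τ) ⊆ U := by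
  obtain ⟨δ, hδ, h⟩ := Metric.nhds_basis_closedBall.mem_iff.1 hU
  exact ⟨Real.log δ, by rwa [Real.exp_log hδ]⟩

theorem envelope_le {x : Euc n} {τ : ℝ} (hx : Metric.closedBall x (Real.exp τ) ⊆ X) :
    envelope B u x ≤ reg B u τ x := iInf₂_le τ hx

theorem envelope_ne_top {x : Euc n} (hx : x ∈ X) : envelope B u x ≠ ⊤ := by
  obtain ⟨τ, hτ⟩ := exists_closedBall_exp_subset (X.isOpen.mem_nhds hx)
  exact ((envelope_le hτ).trans_lt (EReal.coe_lt_top _)).ne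

/-- By monotonicity the infimum is the limit. The infimum runs only over balls inside `X`, so the
default value of `ev` never enters it. -/
theorem tendsto_reg_envelope (hu : RegMono B u) {x : Euc n} (hx : x ∈ X) :
    Filter.Tendsto (fun τ => (reg B u τ x : EReal)) Filter.atBot (𝓝 (envelope B u x)) := by
  obtain ⟨τ₀, hτ₀⟩ := exists_closedBall_exp_subset (X.isOpen.mem_nhds hx)
  refine tendsto_order.2 ⟨fun a ha => ?_, fun b hb => ?_⟩
  · filter_upwards [Filter.eventually_le_atBot τ₀] with τ hτ
    exact ha.trans_le (envelope_le (closedBall_exp_subset_of_le hτ hτ₀))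
  · obtain ⟨τ₁, hτ₁, hlt⟩ := by simpa only [envelope, iInf_lt_iff] using hb
    filter_upwards [Filter.eventually_le_atBot τ₁] with τ hτ
    exact lt_of_le_of_lt (EReal.coe_le_coe_iff.2 (hu x τ τ₁ hτ hτ₁)) hlt

theorem tendsto_nat_sub_atBot (τ₀ : ℝ) :
    Filter.Tendsto (fun k : ℕ => τ₀ - k) Filter.atTop Filter.atBot := by
  simpa [sub_eq_add_neg] using Filter.tendsto_atBot_add_const_left _ τ₀
    (Filter.tendsto_neg_atTop_atBot.comp (tendsto_natCast_atTop_atTop (R := ℝ)))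

/-- The density against nonnegative test functions. -/
theorem integral_envelope_of_nonneg (hB : ∀ z : Euc n, ‖z‖ ^ 2 ≤ bil B z z) (hu : RegMono B u)
    {φ : Euc n → ℝ} (hφ : IsTest X φ) (h0 : ∀ x, 0 ≤ φ x) :
    (∀ᵐ x, φ x ≠ 0 → envelope B u x ≠ ⊥) ∧
      Integrable (fun x => (envelope B u x).toReal * φ x) ∧
      ∫ x, (envelope B u x).toReal * φ x = ev u φ := by
  obtain ⟨τ₀, hτ₀⟩ := exists_cthickening_exp_subset hφ
  have hle : ∀ k : ℕ, τ₀ - k ≤ τ₀ := fun k => sub_le_self _ k.cast_nonneg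
  have hadm : ∀ x, φ x ≠ 0 → Metric.closedBall x (Real.exp τ₀) ⊆ X := fun x hx =>
    closedBall_subset_of_cthickening (hτ₀ τ₀ le_rfl) (subset_tsupport φ hx)
  -- Subtracting from the average at the fixed scale `τ₀` turns the decreasing sequence into a
  -- nonnegative increasing one.
  set f : ℕ → Euc n → ℝ := fun k x => φ x * reg B u τ₀ x - φ x * reg B u (τ₀ - k) x with hf
  have hint : ∀ τ ≤ τ₀, Integrable fun x => φ x * reg B u τ x := fun τ hτ =>
    integrable_mul_reg hB u hφ (hτ₀ τ hτ)
  have hfi : ∀ k, Integrable (f k) := fun k => (hint τ₀ le_rfl).sub (hint _ (hle k))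
  have hf0 : ∀ k x, 0 ≤ f k x := by
    intro k x
    by_cases hx : φ x = 0
    · simp [hf, hx]
    · exact sub_nonneg.2 (mul_le_mul_of_nonneg_left (hu x _ _ (hle k) (hadm x hx)) (h0 x))
  have hfm : ∀ x, Monotone fun k => f k x := by
    intro x k l hkl
    by_cases hx : φ x = 0
    · simp [hf, hx]
    · refine sub_le_sub_left (mul_le_mul_of_nonneg_left (hu x _ _ ?_
        (closedBall_exp_subset_of_le (hle k) (hadm x hx))) (h0 x)) _
      have : (k : ℝ) ≤ l := by exact_mod_cast hkl
      linarith
  have hlim : Filter.Tendsto (fun k => ∫ x, f k x) Filter.atTop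
      (𝓝 ((∫ x, φ x * reg B u τ₀ x) - ev u φ)) := by
    have h1 := (tendsto_integral_mul_reg hB u hφ).comp (tendsto_nat_sub_atBot τ₀)
    refine (h1.const_sub (∫ x, φ x * reg B u τ₀ x)).congr fun k => ?_
    exact (integral_sub (hint τ₀ le_rfl) (hint _ (hle k))).symm
  obtain ⟨C, hC⟩ := hlim.bddAbove_range
  have hC' : ∀ k, ∫ x, f k x ≤ C := fun k => hC ⟨k, rfl⟩
  -- The integrals of `f k` converge, so `f k x` is bounded in `k` for almost every `x`; where `φ x
  -- > 0`, averages tending to `-∞` would violate the bound.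
  have hne : ∀ᵐ x, φ x ≠ 0 → envelope B u x ≠ ⊥ := by
    filter_upwards [ae_bounded_of_monotone hfi hfm hf0 hC'] with x hx hφx hbot
    obtain ⟨M, hM⟩ := hx
    have hpos : 0 < φ x := lt_of_le_of_ne (h0 x) (Ne.symm hφx)
    have hxX : x ∈ X := hφ.tsupport_subset (subset_tsupport φ hφx)
    have ht := (tendsto_reg_envelope hu hxX).comp (tendsto_nat_sub_atBot τ₀)
    rw [hbot, EReal.tendsto_nhds_bot_iff_real] at ht
    obtain ⟨k, hk⟩ := (ht ((φ x * reg B u τ₀ x - M) / φ x)).exists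
    have hk' : reg B u (τ₀ - k) x < (φ x * reg B u τ₀ x - M) / φ x :=
      EReal.coe_lt_coe_iff.1 hk
    rw [lt_div_iff₀ hpos] at hk'
    have := hM k
    simp only [hf] at this
    linarith
  have hF : ∀ᵐ x, Filter.Tendsto (fun k => f k x) Filter.atTop
      (𝓝 (φ x * reg B u τ₀ x - φ x * (envelope B u x).toReal)) := by
    filter_upwards [hne] with x hx
    by_cases hφx : φ x = 0
    · simp [hf, hφx]
    · have hxX : x ∈ X := hφ.tsupport_subset (subset_tsupport φ hφx)
      have ht := (EReal.tendsto_toReal (envelope_ne_top hxX) (hx hφx)).comp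
        ((tendsto_reg_envelope hu hxX).comp (tendsto_nat_sub_atBot τ₀))
      exact (ht.const_mul (φ x)).const_sub _
  have hFi := integrable_of_monotone hfi hf0 hC' hF
  have hlim2 := integral_tendsto_of_tendsto_of_monotone hfi hFi
    (Filter.Eventually.of_forall hfm) hF
  -- The weak limit and the monotone limit of the same integrals agree.
  have heq := tendsto_nhds_unique hlim hlim2
  have hgi : Integrable fun x => (envelope B u x).toReal * φ x := by
    refine ((hint τ₀ le_rfl).sub hFi).congr (Filter.Eventually.of_forall fun x => ?_)
    simp only [Pi.sub_apply]
    ring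
  refine ⟨hne, hgi, ?_⟩
  have hgi' : Integrable fun x => φ x * (envelope B u x).toReal := by
    simpa only [mul_comm] using hgi
  rw [integral_sub (hint τ₀ le_rfl) hgi'] at heq
  simp_rw [mul_comm _ (φ _)]
  linarith

theorem isDensity_envelope (hB : ∀ z : Euc n, ‖z‖ ^ 2 ≤ bil B z z) (hu : RegMono B u) :
    IsDensity u (fun x => (envelope B u x).toReal) := by
  refine ⟨fun x hx => ?_, fun φ => ?_⟩
  · obtain ⟨η, hη, hη0, hη1⟩ := exists_cutoff (X := X) (isCompact_singleton (x := x))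
      (singleton_subset_iff.2 hx)
    rw [nhdsSet_singleton] at hη1
    obtain ⟨-, hi, -⟩ := integral_envelope_of_nonneg hB hu hη hη0
    obtain ⟨s, hs, hso, hxs⟩ := eventually_nhds_iff.1 hη1
    refine ⟨s, mem_nhdsWithin_of_mem_nhds (hso.mem_nhds hxs), ?_⟩
    refine (hi.integrableOn (s := s)).congr_fun (fun y hy => ?_) hso.measurableSet
    simp only [hs y hy, mul_one]
  · have hφ := isTest_coe φ
    -- A test function of arbitrary sign is the difference of `φ + M η` and `M η`, both nonnegative
    -- when `M` bounds `φ` and `η = 1` on its support.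
    obtain ⟨η, hη, hη0, hη1⟩ := exists_cutoff hφ.hasCompactSupport hφ.tsupport_subset
    obtain ⟨M, hM⟩ := hφ.hasCompactSupport.exists_bound_of_continuous hφ.contDiff.continuous
    have hM0 : 0 ≤ M := (norm_nonneg _).trans (hM 0)
    have h1 := (hη.const_mul M)
    have h2 := hφ.add h1
    obtain ⟨-, hi1, he1⟩ := integral_envelope_of_nonneg hB hu h1
      fun x => mul_nonneg hM0 (hη0 x)
    obtain ⟨-, hi2, he2⟩ := integral_envelope_of_nonneg hB hu h2 fun x => by
      by_cases hx : x ∈ tsupport φ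
      · rw [hη1.self_of_nhdsSet x hx, mul_one]
        linarith [neg_abs_le (φ x), hM x, Real.norm_eq_abs (φ x)]
      · rw [image_eq_zero_of_notMem_tsupport hx, zero_add]
        exact mul_nonneg hM0 (hη0 x)
    rw [ev_add_fun u hφ h1, ← he1, ← sub_eq_iff_eq_add, ← integral_sub hi2 hi1, ev_coe] at he2
    rw [← he2]
    exact integral_congr_ae (Filter.Eventually.of_forall fun x => by simp only; ring)

theorem ae_envelope_ne_bot (hB : ∀ z : Euc n, ‖z‖ ^ 2 ≤ bil B z z) (hu : RegMono B u) :
    ∀ᵐ x, x ∈ X → envelope B u x ≠ ⊥ := by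
  have h : volume {x | x ∈ X ∧ envelope B u x = ⊥} = 0 := by
    refine measure_null_of_locally_null _ fun x hx => ?_
    obtain ⟨η, hη, hη0, hη1⟩ := exists_cutoff (X := X) (isCompact_singleton (x := x))
      (singleton_subset_iff.2 hx.1)
    rw [nhdsSet_singleton] at hη1
    obtain ⟨hne, -, -⟩ := integral_envelope_of_nonneg hB hu hη hη0
    refine ⟨{y | η y = 1} ∩ {x | x ∈ X ∧ envelope B u x = ⊥},
      Filter.inter_mem (mem_nhdsWithin_of_mem_nhds hη1) self_mem_nhdsWithin, ?_⟩
    refine measure_mono_null ?_ (ae_iff.1 hne)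
    rintro y ⟨hy, -, hbot⟩ h
    exact h (by rw [show η y = 1 from hy]; exact one_ne_zero) hbot
  filter_upwards [measure_eq_zero_iff_ae_notMem.1 h] with x hx hxX hbot using hx ⟨hxX, hbot⟩

theorem IsTest.integrable_mul {φ g : Euc n → ℝ} (hφ : IsTest X φ)
    (hg : LocallyIntegrableOn g (X : Set (Euc n)) volume) : Integrable fun x => g x * φ x := by
  rw [← integrableOn_iff_integrable_of_support_subset (s := tsupport φ)]
  · exact (hg.integrableOn_compact_subset hφ.tsupport_subset hφ.hasCompactSupport).mul_continuousOn
      hφ.contDiff.continuous.continuousOn hφ.hasCompactSupport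
  · exact (Function.support_mul_subset_right _ _).trans (subset_tsupport φ)

/-- The density of a distribution is unique almost everywhere. -/
theorem IsDensity.ae_eq {g h : Euc n → ℝ} (hg : IsDensity u g) (hh : IsDensity u h) :
    ∀ᵐ x, x ∈ X → g x = h x := by
  have := X.isOpen.ae_eq_zero_of_integral_contDiff_smul_eq_zero (hg.1.sub hh.1)
    fun φ h1 h2 h3 => by
      have hφ : IsTest X φ := ⟨h1, h2, h3⟩
      have e1 := hg.2 hφ.bundle
      have e2 := hh.2 hφ.bundle
      simp only [hφ.coe_bundle] at e1 e2
      simp only [Pi.sub_apply, smul_eq_mul, mul_comm (φ _), sub_mul]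
      rw [integral_sub (hφ.integrable_mul hg.1) (hφ.integrable_mul hh.1), ← e1, ← e2, sub_self]
  filter_upwards [this] with x hx hxX using sub_eq_zero.1 (hx hxX)

theorem IsDensity.eq {v : 𝓓'(X, ℝ)} {g h : Euc n → ℝ} (hg : IsDensity u g) (hh : IsDensity v h)
    (hgh : ∀ᵐ x, x ∈ X → g x = h x) : u = v := by
  ext φ
  rw [hg.2, hh.2]
  refine integral_congr_ae ?_
  filter_upwards [hgh] with x hx
  by_cases hxX : x ∈ X
  · rw [hx hxX]
  · rw [image_eq_zero_of_notMem_tsupport fun h => hxX (φ.tsupport_subset h), mul_zero, mul_zero]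

/-- Strict upper bounds of the envelope hold in a neighbourhood. -/
theorem eventually_envelope_lt (hB : ∀ z : Euc n, ‖z‖ ^ 2 ≤ bil B z z) {x : Euc n} {c : EReal}
    (h : envelope B u x < c) : ∀ᶠ y in 𝓝 x, envelope B u y < c := by
  obtain ⟨τ, hτ, hlt⟩ := by simpa only [envelope, iInf_lt_iff] using h
  have hc : ContinuousAt (fun y => (reg B u τ y : EReal)) x :=
    continuous_coe_real_ereal.continuousAt.comp (reg_continuousAt hB u hτ)
  filter_upwards [hc.eventually_lt continuousAt_const hlt,
    (isOpen_setOf_closedBall_subset (X := X) (Real.exp_pos τ).le).mem_nhds hτ] with y hy hy2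
  exact (envelope_le hy2).trans_lt hy

/-- The essential limit superior of any density is the limit of the averages. -/
theorem essLimsup_eq_envelope (hB : ∀ z : Euc n, ‖z‖ ^ 2 ≤ bil B z z) (hu : RegMono B u)
    {g : Euc n → ℝ} (hg : IsDensity u g) (x : X) : essLimsup X g x = envelope B u x := by
  have hae := hg.ae_eq (isDensity_envelope hB hu)
  have hbot := ae_envelope_ne_bot hB hu
  have hae' : ∀ᵐ y, y ∈ X → (g y : EReal) = envelope B u y := by
    filter_upwards [hae, hbot] with y h1 h2 hy
    rw [h1 hy, EReal.coe_toReal (envelope_ne_top hy) (h2 hy)]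
  refine le_antisymm (le_of_forall_gt_imp_ge_of_dense fun c hc => ?_) ?_
  · have hev := (eventually_envelope_lt hB hc).and (X.isOpen.mem_nhds x.2)
    obtain ⟨r, hr, hsub⟩ := Metric.eventually_nhds_iff_ball.1 hev
    refine (iInf₂_le r hr).trans (essSup_le_of_ae_le c ?_)
    rw [Filter.EventuallyLE, ae_restrict_iff' measurableSet_ball]
    filter_upwards [hae'] with y hy hyr
    rw [hy (hsub y hyr).2]
    exact (hsub y hyr).1.le
  · refine le_iInf₂ fun r hr => ?_
    -- Conversely, an average supported in `X ∩ B_r(x)` has a nonnegative kernel of mass one, hence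
    -- is at most the essential supremum on that ball.
    obtain ⟨τ, hτ⟩ := exists_closedBall_exp_subset
      (Filter.inter_mem (X.isOpen.mem_nhds x.2) (Metric.ball_mem_nhds (x : Euc n) hr))
    have hτX := hτ.trans inter_subset_left
    set m := essSup (fun y => (g y : EReal)) (volume.restrict (Metric.ball (x : Euc n) r))
    have hm : ∀ᵐ y, y ∈ Metric.ball (x : Euc n) r → (g y : EReal) ≤ m := by
      rw [← ae_restrict_iff' measurableSet_ball]
      exact ae_le_essSup
    -- The essential supremum may be infinite, so the comparison is made with real numbers `c` above
    -- it.
    refine (envelope_le hτX).trans (EReal.le_of_forall_lt_iff_le.1 fun c hc => ?_)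
    have hker := isTest_ker hB hτX
    have hcont : Continuous fun y => ker B τ (y - x) := hker.contDiff.continuous
    have hone : ∫ y, ker B τ (y - x) = 1 := by
      rw [integral_sub_right_eq_self (ker B τ) (x : Euc n), integral_ker hB]
    have hreg : reg B u τ x = ∫ y, g y * ker B τ (y - x) := by
      rw [reg, hker.ev_eq, hg.2]; rfl
    rw [EReal.coe_le_coe_iff, hreg]
    calc ∫ y, g y * ker B τ (y - x) ≤ ∫ y, c * ker B τ (y - x) := by
          refine integral_mono_ae (hker.integrable_mul hg.1)
            ((hcont.integrable_of_hasCompactSupport hker.hasCompactSupport).const_mul c) ?_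
          filter_upwards [hm] with y hy
          by_cases hyb : y ∈ Metric.closedBall (x : Euc n) (Real.exp τ)
          · refine mul_le_mul_of_nonneg_right ?_ (ker_nonneg hB _ _)
            exact EReal.coe_le_coe_iff.1 ((hy (hτ hyb).2).trans hc.le)
          · simp [ker_eq_zero hB (sub_notMem_closedBall hyb)]
      _ = c := by rw [integral_const_mul, hone, mul_one]

end Density

/-! ### An elliptic operator in the polar cone -/

section Cone

variable {n : ℕ} {P : ProperCone ℝ (SymMat n)}

theorem traceInner_smul_add_smul (a b : ℝ) (A A' C : SymMat n) :
    traceInner (a • A + b • A') C = a * traceInner A C + b * traceInner A' C := by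
  simp [traceInner, Matrix.add_mul]

theorem zero_mem_polarCone : (0 : SymMat n) ∈ polarCone P := fun C _ => by simp [traceInner]

theorem smul_add_smul_mem_polarCone {A A' : SymMat n} (hA : A ∈ polarCone P)
    (hA' : A' ∈ polarCone P) {a b : ℝ} (ha : 0 ≤ a) (hb : 0 ≤ b) :
    a • A + b • A' ∈ polarCone P := fun C hC => by
  rw [traceInner_smul_add_smul]
  exact add_nonneg (mul_nonneg ha (hA C hC)) (mul_nonneg hb (hA' C hC))

-- A nonempty convex set in finite dimension has nonempty intrinsic interior. The polar contains
-- zero, so its affine span is its linear span and the intrinsic interior is the one used in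
-- `relInt`.
attribute [local instance] Matrix.normedAddCommGroup Matrix.normedSpace in
theorem relInt_polarCone_nonempty (P : ProperCone ℝ (SymMat n)) :
    (relInt (polarCone P)).Nonempty := by
  have hconv : Convex ℝ (polarCone P) := fun A hA A' hA' a b ha hb _ =>
    smul_add_smul_mem_polarCone hA hA' ha hb
  obtain ⟨A, hA⟩ := Set.Nonempty.intrinsicInterior hconv ⟨0, zero_mem_polarCone⟩
  refine ⟨A, intrinsicInterior_subset hA, ?_⟩
  obtain ⟨A', hA', rfl⟩ := hA
  have hspan : (affineSpan ℝ (polarCone P) : Set (SymMat n)) =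
      (Submodule.span ℝ (polarCone P) : Set (SymMat n)) := by
    rw [← affineSpan_insert_zero, insert_eq_of_mem zero_mem_polarCone]
  rw [← hspan, ← map_nhds_subtype_val]
  exact mem_interior_iff_mem_nhds.1 hA'

theorem bil_pos {C : Matrix (Fin n) (Fin n) ℝ} (hC : C.PosDef) {z : Euc n} (hz : z ≠ 0) :
    0 < bil C z z := by
  have h := hC.dotProduct_mulVec_pos (x := z.ofLp) (by simpa using hz)
  have h2 : star z.ofLp ⬝ᵥ (C.mulVec z.ofLp) = bil C z z := by
    simp only [dotProduct, Matrix.mulVec, bil, Finset.mul_sum, star_trivial]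
    exact Finset.sum_congr rfl fun i _ => Finset.sum_congr rfl fun j _ => by ring
  rwa [h2] at h

/-- The form has a positive lower bound on the compact unit sphere, and homogeneity extends the
estimate. -/
theorem exists_norm_sq_le_bil {C : Matrix (Fin n) (Fin n) ℝ} (hC : C.PosDef) :
    ∃ m > 0, ∀ z : Euc n, m * ‖z‖ ^ 2 ≤ bil C z z := by
  obtain ⟨m, hm, h⟩ := (isCompact_sphere (0 : Euc n) 1).exists_forall_le' (a := 0)
    (bil_contDiff C).continuous.continuousOn
    fun z hz => bil_pos hC (ne_zero_of_mem_unit_sphere ⟨z, hz⟩)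
  refine ⟨m, hm, fun z => ?_⟩
  by_cases hz : z = 0
  · simp [hz, bil]
  have hz' : ‖z‖ ≠ 0 := norm_ne_zero_iff.2 hz
  have h1 := h (‖z‖⁻¹ • z) (by simp [norm_smul, hz'])
  rw [bil_smul_smul, inv_pow, ← div_eq_inv_mul, le_div_iff₀ (by positivity)] at h1
  exact h1

/-- An elliptic cone admits a plurisubharmonicity condition given by an elliptic operator,
normalized so that the inverse quadratic form dominates the square of the norm. -/
theorem IsEllipticCone.exists_operator (hP : IsEllipticCone P) :
    ∃ A ∈ polarCone P, ∃ B : Matrix (Fin n) (Fin n) ℝ, B.IsSymm ∧ A.1 * B = 1 ∧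
      ∀ z : Euc n, ‖z‖ ^ 2 ≤ bil B z z := by
  obtain ⟨A, hA⟩ := relInt_polarCone_nonempty P
  have hpos := hP A hA
  obtain ⟨m, hm, h⟩ := exists_norm_sq_le_bil hpos.inv
  -- With `m ‖z‖² ≤ bil A⁻¹ z z`, scaling `A` by `m` keeps it in the cone and makes the lower bound
  -- of the inverse equal to one.
  refine ⟨m • A, ?_, m⁻¹ • A.1⁻¹, ?_, ?_, fun z => ?_⟩
  · simpa using smul_add_smul_mem_polarCone hA.1 hA.1 hm.le le_rfl
  · refine Matrix.IsSymm.smul ?_ _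
    rw [Matrix.IsSymm, Matrix.transpose_nonsing_inv, A.2]
  · have : (m • A).1 = m • A.1 := rfl
    rw [this, Matrix.smul_mul, Matrix.mul_smul, smul_smul, mul_inv_cancel₀ hm.ne', one_smul,
      Matrix.mul_nonsing_inv _ ((Matrix.isUnit_iff_isUnit_det _).1 hpos.isUnit)]
  · have h2 : bil (m⁻¹ • A.1⁻¹) z z = m⁻¹ * bil A.1⁻¹ z z := by
      simp [bil, Finset.mul_sum, mul_assoc]
    rw [h2, ← div_eq_inv_mul, le_div_iff₀ hm, mul_comm]
    exact h z

end Cone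

/-! ### The canonical representative and the cone operations -/

section Representative

variable {n : ℕ} {P : ProperCone ℝ (SymMat n)} {X : Opens (Euc n)}
  {B : Matrix (Fin n) (Fin n) ℝ} {u v : 𝓓'(X, ℝ)}

theorem canonicalRep_eq_envelope (hB : ∀ z : Euc n, ‖z‖ ^ 2 ≤ bil B z z) (hu : RegMono B u) :
    canonicalRep u = fun x : X => envelope B u x := by
  have h : ∃ g : Euc n → ℝ, IsDensity u g := ⟨_, isDensity_envelope hB hu⟩
  rw [canonicalRep, dif_pos h]
  exact funext (essLimsup_eq_envelope hB hu h.choose_spec)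

theorem ae_envelope_eq (hB : ∀ z : Euc n, ‖z‖ ^ 2 ≤ bil B z z) (hu : RegMono B u)
    {g : Euc n → ℝ} (hg : IsDensity u g) : ∀ᵐ x, x ∈ X → envelope B u x = g x := by
  filter_upwards [hg.ae_eq (isDensity_envelope hB hu), ae_envelope_ne_bot hB hu] with x h1 h2 hx
  rw [h1 hx, EReal.coe_toReal (envelope_ne_top hx) (h2 hx)]

theorem envelope_mem_USC (hB : ∀ z : Euc n, ‖z‖ ^ 2 ≤ bil B z z) (hu : RegMono B u) :
    (fun x : X => envelope B u x) ∈ USC X := by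
  refine ⟨fun x c hc => ?_, fun x => envelope_ne_top x.2, fun x => ?_⟩
  · exact (continuous_subtype_val.tendsto x).eventually (eventually_envelope_lt hB hc)
  · obtain ⟨r, hr, hball⟩ := Metric.isOpen_iff.1 X.isOpen x x.2
    -- A ball around `x` inside `X` has positive measure, whereas the envelope is `⊥` only on a null
    -- subset of `X`; being connected, the ball lies in the component of `x`.
    have hne : ∃ y ∈ Metric.ball (x : Euc n) r, envelope B u y ≠ ⊥ := by
      by_contra! h
      refine (Metric.measure_ball_pos volume (x : Euc n) hr).ne' ?_
      refine measure_mono_null (fun y hy => ?_) (ae_iff.1 (ae_envelope_ne_bot hB hu))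
      exact fun hy' => hy' (hball hy) (h y hy)
    obtain ⟨y, hy, hne⟩ := hne
    refine ⟨⟨y, hball hy⟩, ?_, hne⟩
    have hpre : IsPreconnected ((↑) ⁻¹' Metric.ball (x : Euc n) r : Set X) := by
      have himg : ((↑) : X → Euc n) '' ((↑) ⁻¹' Metric.ball (x : Euc n) r) =
          Metric.ball (x : Euc n) r :=
        image_preimage_eq_of_subset fun z hz => ⟨⟨z, hball hz⟩, rfl⟩
      refine (Topology.IsInducing.isPreconnected_image (f := ((↑) : X → Euc n))
        Topology.IsInducing.subtypeVal).1 ?_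
      rw [himg]
      exact (convex_ball (x : Euc n) r).isPreconnected
    exact hpre.subset_connectedComponent (Metric.mem_ball_self hr) hy

theorem reg_smul_add_smul (a b : ℝ) (τ : ℝ) (x : Euc n) :
    reg B (a • u + b • v) τ x = a * reg B u τ x + b * reg B v τ x := ev_smul_add_smul u v a b _

theorem RegMono.smul_add_smul (hu : RegMono B u) (hv : RegMono B v) {a b : ℝ} (ha : 0 ≤ a)
    (hb : 0 ≤ b) : RegMono B (a • u + b • v) := fun x σ τ hστ hx => by
  rw [reg_smul_add_smul, reg_smul_add_smul]
  exact add_le_add (mul_le_mul_of_nonneg_left (hu x σ τ hστ hx) ha)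
    (mul_le_mul_of_nonneg_left (hv x σ τ hστ hx) hb)

theorem coe_mul_ne_top {a : ℝ} (ha : 0 ≤ a) {e : EReal} (he : e ≠ ⊤) : (a : EReal) * e ≠ ⊤ := by
  rcases ha.eq_or_lt with rfl | ha
  · simp
  · induction e with
    | bot => rw [EReal.coe_mul_bot_of_pos ha]; exact bot_ne_top
    | coe e => exact EReal.coe_ne_top (a * e)
    | top => exact absurd rfl he

/-- Limits are taken in an identity that is linear in the averages. Multiplication by a finite
constant is continuous on `EReal`, zero included, and addition is continuous here because neither
limit is `⊤`. -/
theorem envelope_smul_add_smul (hu : RegMono B u) (hv : RegMono B v) {a b : ℝ} (ha : 0 ≤ a)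
    (hb : 0 ≤ b) {x : Euc n} (hx : x ∈ X) :
    envelope B (a • u + b • v) x = (a : EReal) * envelope B u x + (b : EReal) * envelope B v x := by
  have hmul : ∀ {w : 𝓓'(X, ℝ)} (_ : RegMono B w) (c : ℝ),
      Filter.Tendsto (fun τ => (c : EReal) * (reg B w τ x : EReal)) Filter.atBot
        (𝓝 ((c : EReal) * envelope B w x)) := fun hw c =>
    EReal.Tendsto.const_mul (tendsto_reg_envelope hw hx) (Or.inl (EReal.coe_ne_bot c))
      (Or.inl (EReal.coe_ne_top c))
  have hadd := (EReal.continuousAt_add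
    (p := ((a : EReal) * envelope B u x, (b : EReal) * envelope B v x))
    (Or.inl (coe_mul_ne_top ha (envelope_ne_top hx)))
    (Or.inr (coe_mul_ne_top hb (envelope_ne_top hx)))).tendsto.comp
    ((hmul hu a).prodMk_nhds (hmul hv b))
  refine tendsto_nhds_unique (tendsto_reg_envelope (hu.smul_add_smul hv ha hb) hx)
    (hadd.congr fun τ => ?_)
  simp [reg_smul_add_smul]

theorem smul_add_smul_mem_PSHdist (hu : u ∈ PSHdist P X) (hv : v ∈ PSHdist P X) {a b : ℝ}
    (ha : 0 ≤ a) (hb : 0 ≤ b) : a • u + b • v ∈ PSHdist P X := fun A hA φ h0 => by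
  have h1 := hu A hA φ h0
  have h2 := hv A hA φ h0
  rw [hessPairing_apply] at h1 h2 ⊢
  exact add_nonneg (mul_nonneg ha h1) (mul_nonneg hb h2)

end Representative

end PPlus

end

/-! ### The main theorem -/

theorem corollary5p4 (n : ℕ) (P : ProperCone ℝ (PPlus.SymMat n)) (hP : PPlus.IsEllipticCone P)
    (X : Opens (PPlus.Euc n)) :
    -- every plurisubharmonic distribution is an `L¹_loc` function
    (∀ u ∈ PPlus.PSHdist P X, ∃ g : PPlus.Euc n → ℝ, PPlus.IsDensity u g) ∧
    -- which is `L¹_loc`-upper-semicontinuous, with `ũ` its essential limit superior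
    (∀ u ∈ PPlus.PSHdist P X, ∀ g : PPlus.Euc n → ℝ, PPlus.IsDensity u g →
      PPlus.IsL1locUSC X g ∧ PPlus.canonicalRep u = PPlus.essLimsup X g) ∧
    -- `u ↦ ũ` is a bijection ...
    Set.BijOn (PPlus.canonicalRep (X := X)) (PPlus.PSHdist P X) (PPlus.PSHusc P X) ∧
    -- ... that respects the convex cone structures
    (∀ u ∈ PPlus.PSHdist P X, ∀ v ∈ PPlus.PSHdist P X, ∀ a b : ℝ, 0 ≤ a → 0 ≤ b →
      a • u + b • v ∈ PPlus.PSHdist P X ∧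
      PPlus.canonicalRep (a • u + b • v) =
        fun x => (a : EReal) * PPlus.canonicalRep u x + (b : EReal) * PPlus.canonicalRep v x) := by
  obtain ⟨A, hA, B, hBs, hAB, hB⟩ := hP.exists_operator
  have hmono : ∀ u ∈ PPlus.PSHdist P X, PPlus.RegMono B u := fun u hu x σ τ hστ hx =>
    PPlus.reg_mono hu hA hBs hAB hB hστ hx
  have hrep : ∀ u ∈ PPlus.PSHdist P X, PPlus.canonicalRep u = fun x : X => PPlus.envelope B u x :=
    fun u hu => PPlus.canonicalRep_eq_envelope hB (hmono u hu)
  refine ⟨fun u hu => ⟨_, PPlus.isDensity_envelope hB (hmono u hu)⟩, fun u hu g hg => ?_,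
    ⟨fun u hu => ?_, fun u hu v hv huv => ?_, ?_⟩, fun u hu v hv a b ha hb => ?_⟩
  · have hess : PPlus.essLimsup X g = fun x : X => PPlus.envelope B u x :=
      funext (PPlus.essLimsup_eq_envelope hB (hmono u hu) hg)
    refine ⟨⟨hg.1, ?_, ?_⟩, (hrep u hu).trans hess.symm⟩
    · rw [hess]
      exact PPlus.envelope_mem_USC hB (hmono u hu)
    · rw [hess]
      exact PPlus.ae_envelope_eq hB (hmono u hu) hg
  · refine ⟨?_, u, hu, rfl⟩
    rw [hrep u hu]
    exact PPlus.envelope_mem_USC hB (hmono u hu)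
  · rw [hrep u hu, hrep v hv] at huv
    -- Injectivity: equal envelopes on `X` give equal densities, and a density determines its
    -- distribution.
    refine (PPlus.isDensity_envelope hB (hmono u hu)).eq (PPlus.isDensity_envelope hB (hmono v hv))
      (Filter.Eventually.of_forall fun x hx => ?_)
    rw [show PPlus.envelope B u x = PPlus.envelope B v x from congrFun huv ⟨x, hx⟩]
  · rintro f ⟨-, u, hu, rfl⟩
    exact ⟨u, hu, rfl⟩
  · have huv := PPlus.smul_add_smul_mem_PSHdist hu hv ha hb
    refine ⟨huv, ?_⟩
    rw [hrep _ huv, hrep u hu, hrep v hv]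
    exact funext fun x => PPlus.envelope_smul_add_smul (hmono u hu) (hmono v hv) ha hb x.2
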